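/- \textbf{Setting.} Let $V=\{1,\dots,N\}$, $N\ge 1$, with symmetric conductances $\omega_{\{x,y\}}\in[0,\infty)$, $\omega_{\{x,x\}}=0$, such that the graph with edges $\{x,y\}$, $\omega_{\{x,y\}}\neq 0$, is connected; let $\alpha_x\in\{1,2,\dots\}$ for $x\in V$. Let $\sigma\in\{-1,0,1\}$, $\varTheta=[0,1]$ if $\sigma=-1$ and $\varTheta=[0,\infty)$ otherwise; let $\omega_L,\omega_R\ge 0$, $\alpha_L,\alpha_R>0$, $\theta_L,\theta_R\in\varTheta$. Put $\mathcal X=\prod_{x\in V}\{0,\dots,\alpha_x\}$ if $\sigma=-1$, $\mathcal X=\mathbb N_0^V$ otherwise, and $\widehat{\mathcal X}=\mathcal X\times\mathbb N_0^{\{L,R\}}$. For $f:\mathcal X\to\mathbb R$ let $$\mathcal L^{\mathrm{bulk}}f(\eta)=\sum_{\{x,y\}}\omega_{\{x,y\}}\big[\eta(x)(\alpha_y+\sigma\eta(y))(f(\eta-\delta_x+\delta_y)-f(\eta))+\eta(y)(\alpha_x+\sigma\eta(x))(f(\eta-\delta_y+\delta_x)-f(\eta))\big],$$ $$\mathcal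 L f=\mathcal L^{\mathrm{bulk}}f+\omega_L\mathcal L_Lf+\omega_R\mathcal L_Rf,$$ $$\mathcal L_Lf(\eta)=\eta(1)(\alpha_L+\sigma\alpha_L\theta_L)(f(\eta-\delta_1)-f(\eta))+\alpha_L\theta_L(\alpha_1+\sigma\eta(1))(f(\eta+\delta_1)-f(\eta)),$$ and $\mathcal L_R$ likewise with $(N,\alpha_R,\theta_R)$ in place of $(1,\alpha_L,\theta_L)$. For $f:\widehat{\mathcal X}\to\mathbb R$ let $\mathcal L^{\mathrm{bulk}}$ act on the bulk variables and $$\widehat{\mathcal L}f(\xi)=\mathcal L^{\mathrm{bulk}}f(\xi)+\omega_L\alpha_L\xi(1)(f(\xi-\delta_1+\delta_L)-f(\xi))+\omega_R\alpha_R\xi(N)(f(\xi-\delta_N+\delta_R)-f(\xi)).$$ Let $\{\eta_t\}$ and $\{\xi_t\}$ be the continuous-time Markov chains (defined through their minimal transition functions) on $\mathcal X$ and $\widehat{\mathcal X}$ with generators $\mathcal L$ and $\widehat{\mathcal L}$. With $\frac{n!}{(n-\ell)!}:=0$ for $\ell>n$, $(v)_\ell:=v(v+1)\cdots(v+\ell-1)$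 and $0^0:=1$, let, for $k,n\in\mathbb N_0$, $${}_2F_0(-k,-n;-;u)=\sum_{\ell=0}^k\binom k\ell\frac{n!}{(n-\ell)!}u^\ell,\qquad {}_2F_1(-k,-n;v;u)=\sum_{\ell=0}^k\binom k\ell\frac{1}{(v)_\ell}\frac{n!}{(n-\ell)!}u^\ell .$$ Define $w_x(k)=\frac{\alpha_x!}{(\alpha_x-k)!},\ \alpha_x^k,\ (\alpha_x)_k$ for $\sigma=-1,0,1$ respectively, $d^{c\ell}_x(k,n)=\frac{n!}{(n-k)!}\frac1{w_x(k)}$, and $$D^{c\ell}(\xi,\eta)=\theta_L^{\xi(L)}\Big(\prod_{x\in V}d^{c\ell}_x(\xi(x),\eta(x))\Big)\theta_R^{\xi(R)}.$$ \textbf{Theorem.} Let $\theta\in\varTheta$ and $$D^{or}_\theta(\xi,\eta)=(\theta_L-\theta)^{\xi(L)}\Big(\prod_{x\in V}d^{or}_{x,\theta}(\xi(x),\eta(x))\Big)(\theta_R-\theta)^{\xi(R)},$$ $$d^{or}_{x,\theta}(k,n)=(-\theta)^k\times\begin{cases}{}_2F_1(-k,-n;-\alpha_x;\tfrac1\theta)&\sigma=-1\\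 {}_2F_0(-k,-n;-;-\tfrac1{\theta\alpha_x})&\sigma=0\\ {}_2F_1(-k,-n;\alpha_x;-\tfrac1\theta)&\sigma=1\end{cases}$$ where for $\theta=0$ this polynomial in $\theta$ is given its value at $0$, $d^{or}_{x,0}=d^{c\ell}_x$. Then: (1) $\widehat{\mathcal L}D^{or}_\theta(\cdot,\eta)(\xi)=\mathcal L D^{or}_\theta(\xi,\cdot)(\eta)$ for all $\xi\in\widehat{\mathcal X}$, $\eta\in\mathcal X$. (2) Both Markov chains are non-explosive, and for all $\xi\in\widehat{\mathcal X}$, $\eta\in\mathcal X$, $t\ge0$ the variables $D^{or}_\theta(\xi_t,\eta)$ (with $\xi_0=\xi$) and $D^{or}_\theta(\xi,\eta_t)$ (with $\eta_0=\eta$) are integrable and $\widehat{\mathbb E}_\xi[D^{or}_\theta(\xi_t,\eta)]=\mathbb E_\eta[D^{or}_\theta(\xi,\eta_t)]$. (3) $D^{or}_\theta(\cdot,\eta)=e^{-\theta\widehat{\mathcal K}}D^{c\ell}(\cdot,\eta)$ for every $\eta\in\mathcal X$, where $\widehat{\mathcal K}f(\xi)=\sum_{x\in V\cup\{L,R\}}\xi(x)f(\xi-\delta_x)$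 is the annihilation operator and $e^{-\theta\widehat{\mathcal K}}f(\xi)=\sum_{j\ge0}\frac{(-\theta)^j}{j!}\widehat{\mathcal K}^jf(\xi)$. -/

import Mathlib

open MeasureTheory
open scoped NNReal ENNReal

namespace ParticleDuality

/-! ### Continuous-time Markov chains on a countable state space -/

section MarkovChain

variable {S : Type*}

open Classical in
/-- Jump rate from `x` to `y ≠ x`, read off from the generator `L` (`L 1_{y} (x)`). -/
noncomputable def jumpRate (L : (S → ℝ) → S → ℝ) (x y : S) : ℝ≥0∞ :=
  if x = y then 0 else ENNReal.ofReal (L (Pi.single y 1) x)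

open Classical in
/-- Total exit rate from `x` (`-L 1_{x} (x)`). -/
noncomputable def exitRate (L : (S → ℝ) → S → ℝ) (x : S) : ℝ :=
  -L (Pi.single x 1) x

open Classical in
/-- Probability that the jump chain with generator `L` started at `x` is at `y` at time `t ≥ 0`
and has made fewer than `n` jumps up to time `t` (decomposition at the first jump time, which is
exponential with parameter `exitRate L x`). -/
noncomputable def transitionApprox (L : (S → ℝ) → S → ℝ) : ℕ → ℝ → S → S → ℝ≥0∞
  | 0 => fun _ _ _ => 0
  | n + 1 => fun t x y =>
      (if x = y then ENNReal.ofReal (Real.exp (-(exitRate L x * t))) else 0) +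
        ∫⁻ s in Set.Icc 0 t, ENNReal.ofReal (Real.exp (-(exitRate L x * s))) *
          ∑' z, jumpRate L x z * transitionApprox L n (t - s) z y

/-- Transition probabilities `p_t(x, y)` of the Markov chain with generator `L` (Feller's minimal
transition function). -/
noncomputable def transition (L : (S → ℝ) → S → ℝ) (t : ℝ≥0) (x y : S) : ℝ≥0∞ :=
  ⨆ n, transitionApprox L n t x y

/-- The law at time `t` of the Markov chain with generator `L` started at `x`. -/
noncomputable def lawAt [MeasurableSpace S] (L : (S → ℝ) → S → ℝ) (x : S) (t : ℝ≥0) : Measure S :=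
  Measure.sum fun y => transition L t x y • Measure.dirac y

/-- `X` is, under `P`, a Markov chain with generator `L` started at `x`: its finite-dimensional
distributions are those given by the transition probabilities. -/
structure IsMarkovChain [MeasurableSpace S] {Ω : Type*} [MeasurableSpace Ω]
    (L : (S → ℝ) → S → ℝ) (P : Measure Ω) (X : ℝ≥0 → Ω → S) (x : S) : Prop where
  isProbabilityMeasure : IsProbabilityMeasure P
  measurable : ∀ t, Measurable (X t)
  finite_dim : ∀ (n : ℕ) (t : ℕ → ℝ≥0) (y : ℕ → S), Monotone t → t 0 = 0 → y 0 = x →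
    P {ω | ∀ i ≤ n, X (t i) ω = y i} =
      ∏ i ∈ Finset.range n, transition L (t (i + 1) - t i) (y i) (y (i + 1))

end MarkovChain

/-! ### The model -/

/-- The set `Θ` of admissible scale parameters. -/
def scaleSet (σ : SignType) : Set ℝ := if σ = -1 then Set.Icc 0 1 else Set.Ici 0

/-- Parameters of the system: the sites are `Fin (N + 1)`, the left reservoir is attached to
site `0` and the right one to site `Fin.last N`. -/
structure Params (σ : SignType) (N : ℕ) where
  /-- bulk conductances -/
  ω : Fin (N + 1) → Fin (N + 1) → ℝ
  ω_nonneg : ∀ x y, 0 ≤ ω x y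
  ω_symm : ∀ x y, ω x y = ω y x
  ω_diag : ∀ x, ω x x = 0
  connected : (SimpleGraph.fromRel fun x y => ω x y ≠ 0).Connected
  /-- bulk site parameters -/
  α : Fin (N + 1) → ℕ
  α_pos : ∀ x, 0 < α x
  ωL : ℝ
  ωR : ℝ
  ωL_nonneg : 0 ≤ ωL
  ωR_nonneg : 0 ≤ ωR
  αL : ℝ
  αR : ℝ
  αL_pos : 0 < αL
  αR_pos : 0 < αR
  θL : ℝ
  θR : ℝ
  θL_mem : θL ∈ scaleSet σ
  θR_mem : θR ∈ scaleSet σ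

variable {σ : SignType} {N : ℕ}

/-- Configuration space `𝒳`: at most `α x` particles at `x` for exclusion (`σ = -1`), no
restriction otherwise. -/
abbrev Config (p : Params σ N) : Type :=
  {η : Fin (N + 1) → ℕ // σ = -1 → ∀ x, η x ≤ p.α x}

/-- Configuration space of the dual: a bulk configuration, `ξ(L)` and `ξ(R)`. -/
abbrev DualConfig (p : Params σ N) : Type := Config p × ℕ × ℕ

open Classical in
/-- The configuration `η'` if it is admissible, and `η` otherwise (all transitions towards a
non-admissible `η'` have rate zero). -/
noncomputable def Config.moveTo {p : Params σ N} (η : Config p) (η' : Fin (N + 1) → ℕ) : Config p :=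
  if h : σ = -1 → ∀ x, η' x ≤ p.α x then ⟨η', h⟩ else η

/-- `η - δ_x + δ_y` -/
noncomputable def Config.hop {p : Params σ N} (η : Config p) (x y : Fin (N + 1)) : Config p :=
  η.moveTo (η.1 - Pi.single x 1 + Pi.single y 1)

/-- `η - δ_x` -/
noncomputable def Config.remove {p : Params σ N} (η : Config p) (x : Fin (N + 1)) : Config p :=
  η.moveTo (η.1 - Pi.single x 1)

/-- `η + δ_x` -/
noncomputable def Config.insert {p : Params σ N} (η : Config p) (x : Fin (N + 1)) : Config p :=
  η.moveTo (η.1 + Pi.single x 1)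

/-- Single-bond generator. -/
noncomputable def bondGen (p : Params σ N) (x y : Fin (N + 1)) (f : Config p → ℝ)
    (η : Config p) : ℝ :=
  η.1 x * (p.α y + σ * η.1 y) * (f (η.hop x y) - f η) +
    η.1 y * (p.α x + σ * η.1 x) * (f (η.hop y x) - f η)

/-- Bulk generator: the sum over unordered pairs of sites. -/
noncomputable def bulkGen (p : Params σ N) (f : Config p → ℝ) (η : Config p) : ℝ :=
  ∑ x, ∑ y ∈ Finset.Ioi x, p.ω x y * bondGen p x y f η

/-- Reservoir with site parameter `a` and scale parameter `ϑ`, attached to the site `x`. -/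
noncomputable def reservoirGen (p : Params σ N) (a ϑ : ℝ) (x : Fin (N + 1)) (f : Config p → ℝ)
    (η : Config p) : ℝ :=
  η.1 x * (a + σ * a * ϑ) * (f (η.remove x) - f η) +
    a * ϑ * (p.α x + σ * η.1 x) * (f (η.insert x) - f η)

/-- Generator of the boundary driven system. -/
noncomputable def gen (p : Params σ N) (f : Config p → ℝ) (η : Config p) : ℝ :=
  bulkGen p f η +
    (p.ωL * reservoirGen p p.αL p.θL 0 f η +
      p.ωR * reservoirGen p p.αR p.θR (Fin.last N) f η)

/-- Generator of the dual system, with absorbing sites `L` and `R`. -/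
noncomputable def dualGen (p : Params σ N) (f : DualConfig p → ℝ) (ξ : DualConfig p) : ℝ :=
  bulkGen p (fun ζ => f (ζ, ξ.2)) ξ.1 +
    (p.ωL * (p.αL * ξ.1.1 0 * (f (ξ.1.remove 0, ξ.2.1 + 1, ξ.2.2) - f ξ)) +
      p.ωR * (p.αR * ξ.1.1 (Fin.last N) *
        (f (ξ.1.remove (Fin.last N), ξ.2.1, ξ.2.2 + 1) - f ξ)))

/-- Annihilation operator on all sites, including `L` and `R`. -/
noncomputable def annihilation (p : Params σ N) (f : DualConfig p → ℝ) (ξ : DualConfig p) : ℝ :=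
  (∑ x, ξ.1.1 x * f (ξ.1.remove x, ξ.2)) +
    (ξ.2.1 * f (ξ.1, ξ.2.1 - 1, ξ.2.2) + ξ.2.2 * f (ξ.1, ξ.2.1, ξ.2.2 - 1))

/-! ### Duality functions -/

/-- The weights `w_x(k)`, for a site with parameter `a`: `a! / (a - k)!` (zero for `k > a`),
`a ^ k`, and `a (a + 1) ⋯ (a + k - 1)`, respectively. -/
def weight (σ : SignType) (a k : ℕ) : ℕ :=
  match σ with
  | .neg => a.descFactorial k
  | .zero => a ^ k
  | .pos => a.ascFactorial k

/-- Classical single-site duality function; `n.descFactorial k` is `n! / (n - k)!`, and zero for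
`k > n`. -/
noncomputable def classicalSite (σ : SignType) (a k n : ℕ) : ℝ :=
  (n.descFactorial k : ℝ) / weight σ a k

/-- Classical duality function. -/
noncomputable def classicalDuality (p : Params σ N) (ξ : DualConfig p) (η : Config p) : ℝ :=
  p.θL ^ ξ.2.1 * (∏ x, classicalSite σ (p.α x) (ξ.1.1 x) (η.1 x)) * p.θR ^ ξ.2.2

/-- `₂F₀(-k, -n; -; u)` -/
noncomputable def hyp20 (k n : ℕ) (u : ℝ) : ℝ :=
  ∑ l ∈ Finset.range (k + 1), (k.choose l : ℝ) * n.descFactorial l * u ^ l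

/-- `₂F₁(-k, -n; v; u)` -/
noncomputable def hyp21 (k n : ℕ) (v u : ℝ) : ℝ :=
  ∑ l ∈ Finset.range (k + 1),
    (k.choose l : ℝ) * (n.descFactorial l / (ascPochhammer ℝ l).eval v) * u ^ l

/-- Orthogonal single-site duality function, for a site with parameter `a`. The formula with
`1 / θ` is a polynomial in `θ`; its value at `θ = 0` is the classical single-site function. -/
noncomputable def orthogonalSite (σ : SignType) (θ : ℝ) (a k n : ℕ) : ℝ :=
  if θ = 0 then classicalSite σ a k n
  else (-θ) ^ k *
    match σ with
    | .neg => hyp21 k n (-(a : ℝ)) (1 / θ)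
    | .zero => hyp20 k n (-(1 / (θ * a)))
    | .pos => hyp21 k n (a : ℝ) (-(1 / θ))

/-- Orthogonal duality function. -/
noncomputable def orthogonalDuality (p : Params σ N) (θ : ℝ) (ξ : DualConfig p) (η : Config p) :
    ℝ :=
  (p.θL - θ) ^ ξ.2.1 * (∏ x, orthogonalSite σ θ (p.α x) (ξ.1.1 x) (η.1 x)) *
    (p.θR - θ) ^ ξ.2.2

end ParticleDuality

/-! On one site the orthogonal function is the classical one transformed by `e^{-θK}`, with `K` the
annihilation operator in the dual variable `k`. This transform commutes with `K`, turns the shift in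
`k` into the shift plus `θ`, and turns multiplication by `k` into `k + θK`. Conjugating three
classical recurrences therefore yields `transformedSite_sub`, `mul_transformedSite_pred` and
`mul_transformedSite_succ`, which relate changes of `n` to changes of `k`. Duality of the generators
is then algebra on each bond (`siteProd_bond`) and at each reservoir (`siteProd_reservoir`).

Passing to expectations is delicate because rates and duality function may be unbounded and the
function has no sign. The dual conserves particles, so it lives on finite levels, and
`evolvedDuality` is a matrix exponential of the dual generator applied to the duality function. The
two generators act on different variables, so it solves the backward equations of both chains. What
remains is uniqueness, `integral_lawAt_eq`: a solution dominated by a Lyapunov function `V` is the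
expectation under the minimal transition function. Adding `C e^{λt} V` makes the solution
nonnegative. Comparison with the chain allowed fewer than `n` jumps leaves an error controlled by
the iterates of `(q + L) / (λ + q)` on `V`. They decrease to some `u` with `0 ≤ u ≤ V` and `L u = λ
u`, and a maximum principle against a second Lyapunov function `W`, with `V / W` vanishing at
infinity, gives `u = 0`. Non-explosion is the case of the constant solution `1`. The driven system
uses rising factorials of the particle number, the dual uses functions of its conserved particle
number.

For the exponential formula, both sides satisfy the same equation `d/dθ = -K` with the same value at
`θ = 0`; induction on the number of dual particles closes the argument. -/

namespace ParticleDuality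

/-! ### Generators with finitely many kinds of jumps -/

section Chain

variable {S : Type*} {ι : Type*} [Fintype ι] {L : (S → ℝ) → S → ℝ} {r : ι → S → ℝ}
  {φ : ι → S → S}

/-- `L` is the generator of the chain which jumps from `x` to `φ i x` at rate `r i x`. -/
structure IsJumpForm (L : (S → ℝ) → S → ℝ) (r : ι → S → ℝ) (φ : ι → S → S) : Prop where
  nonneg : ∀ i x, 0 ≤ r i x
  eq_sum : ∀ f x, L f x = ∑ i, r i x * (f (φ i x) - f x)

open Classical in
/-- The off-diagonal part of the generator, acting on functions with values in `[0, ∞]`. -/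
noncomputable def jumpOp (r : ι → S → ℝ) (φ : ι → S → S) (F : S → ℝ≥0∞) (x : S) : ℝ≥0∞ :=
  -- Null jumps cancel in `L` but would inflate the rates; dropping them makes this operator agree
  -- with `jumpRate`.
  ∑ i, if φ i x = x then 0 else ENNReal.ofReal (r i x) * F (φ i x)

lemma jumpOp_add (F G : S → ℝ≥0∞) (x : S) :
    jumpOp r φ (fun y => F y + G y) x = jumpOp r φ F x + jumpOp r φ G x := by
  classical
  simp only [jumpOp, ← Finset.sum_add_distrib]
  refine Finset.sum_congr rfl fun i _ => ?_
  split_ifs <;> simp [mul_add]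

lemma jumpOp_mono {F G : S → ℝ≥0∞} (h : ∀ y, F y ≤ G y) (x : S) :
    jumpOp r φ F x ≤ jumpOp r φ G x := by
  classical
  refine Finset.sum_le_sum fun i _ => ?_
  split_ifs
  · rfl
  · gcongr
    exact h _

lemma jumpOp_tsum {κ : Type*} (F : κ → S → ℝ≥0∞) (x : S) :
    jumpOp r φ (fun y => ∑' k, F k y) x = ∑' k, jumpOp r φ (F k) x := by
  classical
  simp only [jumpOp]
  rw [Summable.tsum_finsetSum fun _ _ => ENNReal.summable]
  refine Finset.sum_congr rfl fun i _ => ?_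
  split_ifs
  · simp
  · rw [ENNReal.tsum_mul_left]

lemma jumpOp_mul_const (F : S → ℝ≥0∞) (c : ℝ≥0∞) (x : S) :
    jumpOp r φ (fun y => F y * c) x = jumpOp r φ F x * c := by
  classical
  simp only [jumpOp, Finset.sum_mul]
  refine Finset.sum_congr rfl fun i _ => ?_
  split_ifs <;> simp [mul_assoc]

lemma measurable_jumpOp {F : ℝ → S → ℝ≥0∞} (h : ∀ y, Measurable fun t => F t y) (x : S) :
    Measurable fun t => jumpOp r φ (F t) x := by
  classical
  refine Finset.measurable_sum _ fun i _ => ?_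
  split_ifs
  · exact measurable_const
  · exact (h _).const_mul _

namespace IsJumpForm

variable (hL : IsJumpForm L r φ)
include hL

open Classical in
lemma exitRate_eq (x : S) : exitRate L x = ∑ i, if φ i x = x then 0 else r i x := by
  rw [exitRate, hL.eq_sum, ← Finset.sum_neg_distrib]
  refine Finset.sum_congr rfl fun i _ => ?_
  by_cases h : φ i x = x <;> simp [h]

lemma exitRate_nonneg (x : S) : 0 ≤ exitRate L x := by
  classical
  rw [hL.exitRate_eq]
  refine Finset.sum_nonneg fun i _ => ?_
  split_ifs
  exacts [le_rfl, hL.nonneg i x]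

-- Adding the exit rate cancels the diagonal of `L` and leaves nonnegative coefficients. All
-- positivity and monotonicity used below comes from this.
open Classical in
lemma add_exitRate_mul (f : S → ℝ) (x : S) :
    exitRate L x * f x + L f x = ∑ i, if φ i x = x then 0 else r i x * f (φ i x) := by
  rw [hL.exitRate_eq, hL.eq_sum, Finset.sum_mul, ← Finset.sum_add_distrib]
  refine Finset.sum_congr rfl fun i _ => ?_
  by_cases h : φ i x = x
  · simp [h]
  · simp [h]; ring

lemma ofReal_add_exitRate_mul {f : S → ℝ} (hf : ∀ y, 0 ≤ f y) (x : S) :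
    ENNReal.ofReal (exitRate L x * f x + L f x) = jumpOp r φ (fun y => ENNReal.ofReal (f y)) x := by
  classical
  rw [hL.add_exitRate_mul, jumpOp, ENNReal.ofReal_sum_of_nonneg]
  · refine Finset.sum_congr rfl fun i _ => ?_
    split_ifs
    · simp
    · rw [ENNReal.ofReal_mul (hL.nonneg i x)]
  · intro i _
    split_ifs
    exacts [le_rfl, mul_nonneg (hL.nonneg i x) (hf _)]

lemma add_exitRate_mul_nonneg {f : S → ℝ} (hf : ∀ y, 0 ≤ f y) (x : S) :
    0 ≤ exitRate L x * f x + L f x := by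
  classical
  rw [hL.add_exitRate_mul]
  refine Finset.sum_nonneg fun i _ => ?_
  split_ifs
  exacts [le_rfl, mul_nonneg (hL.nonneg i x) (hf _)]

lemma add_exitRate_mul_mono {f g : S → ℝ} (h : ∀ y, f y ≤ g y) (x : S) :
    exitRate L x * f x + L f x ≤ exitRate L x * g x + L g x := by
  classical
  rw [hL.add_exitRate_mul, hL.add_exitRate_mul]
  refine Finset.sum_le_sum fun i _ => ?_
  split_ifs
  exacts [le_rfl, mul_le_mul_of_nonneg_left (h _) (hL.nonneg i x)]

lemma map_add (f g : S → ℝ) (x : S) : L (fun y => f y + g y) x = L f x + L g x := by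
  simp only [hL.eq_sum, ← Finset.sum_add_distrib]
  exact Finset.sum_congr rfl fun i _ => by ring

lemma map_const_mul (c : ℝ) (f : S → ℝ) (x : S) : L (fun y => c * f y) x = c * L f x := by
  simp only [hL.eq_sum, Finset.mul_sum]
  exact Finset.sum_congr rfl fun i _ => by ring

lemma map_const (c : ℝ) (x : S) : L (fun _ => c) x = 0 := by
  simp [hL.eq_sum]

/-- Several kinds of jump may reach the same `z`; regrouping by target point adds their rates. -/
lemma tsum_jumpRate_mul (F : S → ℝ≥0∞) (x : S) :
    ∑' z, jumpRate L x z * F z = jumpOp r φ F x := by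
  classical
  have h : ∀ z, jumpRate L x z * F z =
      ∑ i, if z = φ i x then (if φ i x = x then 0 else ENNReal.ofReal (r i x) * F z) else 0 := by
    intro z
    rw [jumpRate]
    split_ifs with hxz
    · subst hxz
      rw [zero_mul]
      symm
      refine Finset.sum_eq_zero fun i _ => ?_
      split_ifs with h1 h2
      · rfl
      · exact absurd h1.symm h2
      · rfl
    · rw [hL.eq_sum, ENNReal.ofReal_sum_of_nonneg, Finset.sum_mul]
      · refine Finset.sum_congr rfl fun i _ => ?_
        by_cases h1 : z = φ i x
        · have h2 : φ i x ≠ x := fun h => hxz (h1.trans h).symm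
          simp [← h1, hxz, h1 ▸ h2]
        · have h2 : φ i x ≠ z := fun h => h1 h.symm
          simp [h1, h2, hxz]
      · intro i _
        refine mul_nonneg (hL.nonneg i x) ?_
        have : (Pi.single z 1 : S → ℝ) x = 0 := by simp [hxz]
        rw [this, sub_zero, Pi.single_apply]
        split_ifs <;> norm_num
  simp only [h]
  rw [Summable.tsum_finsetSum fun _ _ => ENNReal.summable, jumpOp]
  refine Finset.sum_congr rfl fun i _ => ?_
  rw [tsum_eq_single (φ i x) (fun z hz => by simp [hz])]
  simp

end IsJumpForm

/-! ### The approximating semigroups -/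

lemma measurable_lintegral_Icc {f g : ℝ → ℝ≥0∞} (hf : Measurable f) (hg : Measurable g) :
    Measurable fun t => ∫⁻ s in Set.Icc 0 t, f s * g (t - s) := by
  have h : ∀ t : ℝ, ∫⁻ s in Set.Icc 0 t, f s * g (t - s) =
      ∫⁻ s, Set.indicator {q : ℝ × ℝ | 0 ≤ q.2 ∧ q.2 ≤ q.1}
        (fun q => f q.2 * g (q.1 - q.2)) (t, s) := by
    intro t
    rw [← lintegral_indicator measurableSet_Icc]
    refine lintegral_congr fun s => ?_
    simp [Set.indicator_apply]
  simp only [h]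
  refine Measurable.lintegral_prod_right' (Measurable.indicator ?_ ?_)
  · exact (hf.comp measurable_snd).mul (hg.comp (measurable_fst.sub measurable_snd))
  · exact (measurableSet_le measurable_const measurable_snd).inter
      (measurableSet_le measurable_snd measurable_fst)

lemma measurable_expDecay (q : ℝ) :
    Measurable fun s : ℝ => ENNReal.ofReal (Real.exp (-(q * s))) := by fun_prop

/-- The approximating kernel, with fewer than `n` jumps, applied to a function. -/
noncomputable def approxSemigroup (L : (S → ℝ) → S → ℝ) (n : ℕ) (t : ℝ) (F : S → ℝ≥0∞) (x : S) :
    ℝ≥0∞ :=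
  ∑' y, transitionApprox L n t x y * F y

namespace IsJumpForm

variable (hL : IsJumpForm L r φ)
include hL

open Classical in
lemma transitionApprox_succ (n : ℕ) (t : ℝ) (x y : S) :
    transitionApprox L (n + 1) t x y =
      (if x = y then ENNReal.ofReal (Real.exp (-(exitRate L x * t))) else 0) +
        ∫⁻ s in Set.Icc 0 t, ENNReal.ofReal (Real.exp (-(exitRate L x * s))) *
          jumpOp r φ (fun z => transitionApprox L n (t - s) z y) x := by
  simp only [transitionApprox, hL.tsum_jumpRate_mul]

lemma measurable_transitionApprox (n : ℕ) (x y : S) :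
    Measurable fun t => transitionApprox L n t x y := by
  classical
  induction n generalizing x with
  | zero => exact measurable_const
  | succ n ih =>
    simp only [hL.transitionApprox_succ]
    refine Measurable.add ?_ ?_
    · split_ifs
      · exact measurable_expDecay _
      · exact measurable_const
    · exact measurable_lintegral_Icc (measurable_expDecay _)
        (g := fun u => jumpOp r φ (fun z => transitionApprox L n u z y) x)
        (measurable_jumpOp (fun z => ih z) x)

lemma monotone_transitionApprox (t : ℝ) (x y : S) :
    Monotone fun n => transitionApprox L n t x y := by
  classical
  refine monotone_nat_of_le_succ fun n => ?_
  induction n generalizing t x with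
  | zero => exact zero_le
  | succ n ih =>
    rw [hL.transitionApprox_succ, hL.transitionApprox_succ]
    gcongr with s
    exact jumpOp_mono (fun z => ih _ z) x

variable [Countable S]

lemma measurable_approxSemigroup (n : ℕ) (F : S → ℝ≥0∞) (x : S) :
    Measurable fun t => approxSemigroup L n t F x :=
  Measurable.tsum fun y => (hL.measurable_transitionApprox n x y).mul_const _

lemma approxSemigroup_succ (n : ℕ) (t : ℝ) (F : S → ℝ≥0∞) (x : S) :
    approxSemigroup L (n + 1) t F x =
      ENNReal.ofReal (Real.exp (-(exitRate L x * t))) * F x +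
        ∫⁻ s in Set.Icc 0 t, ENNReal.ofReal (Real.exp (-(exitRate L x * s))) *
          jumpOp r φ (approxSemigroup L n (t - s) F) x := by
  classical
  simp only [approxSemigroup, hL.transitionApprox_succ, add_mul]
  rw [ENNReal.tsum_add]
  congr 1
  · rw [tsum_eq_single x (fun y hy => by simp [hy.symm])]
    simp
  · have hm : ∀ y, Measurable fun s : ℝ => ENNReal.ofReal (Real.exp (-(exitRate L x * s))) *
        jumpOp r φ (fun z => transitionApprox L n (t - s) z y) x := fun y =>
      (measurable_expDecay _).mul (measurable_jumpOp (F := fun s z => transitionApprox L n (t - s) z y)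
        (fun z => (hL.measurable_transitionApprox n z y).comp (measurable_const.sub measurable_id)) x)
    simp only [← lintegral_mul_const _ (hm _)]
    rw [← lintegral_tsum fun y => ((hm y).mul_const _).aemeasurable]
    refine lintegral_congr fun s => ?_
    unfold approxSemigroup
    rw [jumpOp_tsum, ← ENNReal.tsum_mul_left]
    refine tsum_congr fun y => ?_
    rw [jumpOp_mul_const, mul_assoc]

end IsJumpForm

/-! ### Comparison of solutions of the backward equation -/

/-- Variation of constants: `-e^{-qs} k(t - s)` has derivative `e^{-qs} (q k + k')(t - s)`. This
puts a differentiable function in the shape of the first-jump decomposition `approxSemigroup_succ`.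
-/
lemma ofReal_eq_add_lintegral {k k' : ℝ → ℝ} {q t : ℝ} (ht : 0 ≤ t)
    (hk : ∀ u, HasDerivAt k (k' u) u) (hk' : Continuous k')
    (h0 : 0 ≤ k 0) (hnn : ∀ u ∈ Set.Icc 0 t, 0 ≤ q * k u + k' u) :
    ENNReal.ofReal (k t) = ENNReal.ofReal (Real.exp (-(q * t))) * ENNReal.ofReal (k 0) +
      ∫⁻ s in Set.Icc 0 t, ENNReal.ofReal (Real.exp (-(q * s))) *
        ENNReal.ofReal (q * k (t - s) + k' (t - s)) := by
  have hkc : Continuous k := continuous_iff_continuousAt.2 fun u => (hk u).continuousAt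
  have hd : ∀ s ∈ Set.uIcc 0 t, HasDerivAt (fun s => -(Real.exp (-(q * s)) * k (t - s)))
      (Real.exp (-(q * s)) * (q * k (t - s) + k' (t - s))) s := by
    intro s _
    have h1 : HasDerivAt (fun s => k (t - s)) (k' (t - s) * (-1)) s :=
      (hk (t - s)).comp s ((hasDerivAt_id s).const_sub t)
    have h2 : HasDerivAt (fun s => Real.exp (-(q * s))) (Real.exp (-(q * s)) * (-(q * 1))) s :=
      (((hasDerivAt_id s).const_mul q).neg).exp
    exact (h2.mul h1).neg.congr_deriv (by ring)
  have hc : Continuous fun s => Real.exp (-(q * s)) * (q * k (t - s) + k' (t - s)) := by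
    fun_prop
  have hI := intervalIntegral.integral_eq_sub_of_hasDerivAt hd (hc.intervalIntegrable 0 t)
  have hnn' : ∀ s ∈ Set.Icc 0 t, 0 ≤ Real.exp (-(q * s)) * (q * k (t - s) + k' (t - s)) :=
    fun s hs => mul_nonneg (Real.exp_nonneg _)
      (hnn _ ⟨sub_nonneg.2 hs.2, by linarith [hs.1]⟩)
  rw [intervalIntegral.integral_of_le ht, ← integral_Icc_eq_integral_Ioc] at hI
  simp only [sub_self, mul_zero, neg_zero, Real.exp_zero, sub_zero, one_mul] at hI
  have hlin : ∫⁻ s in Set.Icc 0 t, ENNReal.ofReal (Real.exp (-(q * s))) *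
        ENNReal.ofReal (q * k (t - s) + k' (t - s)) =
      ENNReal.ofReal (∫ s in Set.Icc 0 t, Real.exp (-(q * s)) * (q * k (t - s) + k' (t - s))) := by
    rw [ofReal_integral_eq_lintegral_ofReal (hc.integrableOn_Icc)
      ((ae_restrict_iff' measurableSet_Icc).2 (Filter.Eventually.of_forall hnn'))]
    refine lintegral_congr fun s => ?_
    rw [ENNReal.ofReal_mul (Real.exp_nonneg _)]
  rw [hlin, ← ENNReal.ofReal_mul (Real.exp_nonneg _), ← ENNReal.ofReal_add
    (mul_nonneg (Real.exp_nonneg _) h0) (setIntegral_nonneg measurableSet_Icc hnn'), hI]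
  congr 1
  ring

/-- The iterates of `(q + L) / (lam + q)`, where `q` is the exit rate. -/
noncomputable def resolventIter (L : (S → ℝ) → S → ℝ) (lam : ℝ) (V : S → ℝ) : ℕ → S → ℝ
  | 0 => V
  | n + 1 => fun x =>
      (exitRate L x * resolventIter L lam V n x + L (resolventIter L lam V n) x) /
        (lam + exitRate L x)

namespace IsJumpForm

variable (hL : IsJumpForm L r φ)
include hL

/-- Maximum principle. If `u ≠ 0`, the ratio `u / W` attains a maximum `M > 0` at some `z`, and
there `λ u = L u ≤ M L W ≤ c M W = c u`, against `c < λ`. -/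
lemma eq_zero_of_harmonic {lam c : ℝ} (hc : c < lam) {u V W : S → ℝ} (hu : ∀ x, 0 ≤ u x)
    (huV : ∀ x, u x ≤ V x) (hLu : ∀ x, L u x = lam * u x) (hW : ∀ x, 0 < W x)
    (hLW : ∀ x, L W x ≤ c * W x) (hfin : ∀ K, {x | W x ≤ K * V x}.Finite) (x : S) : u x = 0 := by
  by_contra hx
  have hx : 0 < u x := lt_of_le_of_ne (hu x) (Ne.symm hx)
  -- Where `u / W` is at least its value at `x`, one has `W ≤ (W x / u x) u ≤ (W x / u x) V`, so the
  -- superlevel set is finite.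
  obtain ⟨z, hz, hmax⟩ := Set.exists_max_image {y | u x / W x ≤ u y / W y} (fun y => u y / W y)
    ((hfin (W x / u x)).subset fun y hy => by
      have hy : u x / W x ≤ u y / W y := hy
      rw [div_le_div_iff₀ (hW x) (hW y)] at hy
      change W y ≤ W x / u x * V y
      rw [div_mul_eq_mul_div, le_div_iff₀ hx]
      nlinarith [mul_le_mul_of_nonneg_left (huV y) (hW x).le])
    ⟨x, le_refl (u x / W x)⟩
  set M := u z / W z with hM
  have hMpos : 0 < M := (div_pos hx (hW x)).trans_le hz
  have hle : ∀ y, u y ≤ M * W y := by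
    intro y
    rw [← div_le_iff₀ (hW y)]
    by_cases hy : u x / W x ≤ u y / W y
    · exact hmax y hy
    · exact (not_le.1 hy).le.trans hz
  have hzeq : u z = M * W z := by rw [hM, div_mul_cancel₀ _ (hW z).ne']
  have h1 : L u z ≤ M * L W z := by
    rw [hL.eq_sum, hL.eq_sum, Finset.mul_sum]
    refine Finset.sum_le_sum fun i _ => ?_
    have := mul_le_mul_of_nonneg_left (hle (φ i z)) (hL.nonneg i z)
    rw [hzeq]
    linarith
  have h2 : M * L W z ≤ M * (c * W z) := mul_le_mul_of_nonneg_left (hLW z) hMpos.le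
  rw [hLu, hzeq] at h1
  have : 0 < M * W z := mul_pos hMpos (hW z)
  nlinarith

lemma resolventIter_nonneg {lam : ℝ} (hlam : 0 < lam) {V : S → ℝ} (hV : ∀ x, 0 ≤ V x) (n : ℕ)
    (x : S) : 0 ≤ resolventIter L lam V n x := by
  induction n generalizing x with
  | zero => exact hV x
  | succ n ih =>
    exact div_nonneg (hL.add_exitRate_mul_nonneg ih x)
      (add_nonneg hlam.le (hL.exitRate_nonneg x))

lemma resolventIter_antitone {lam : ℝ} (hlam : 0 < lam) {V : S → ℝ}
    (hLV : ∀ x, L V x ≤ lam * V x) (x : S) : Antitone fun n => resolventIter L lam V n x := by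
  refine antitone_nat_of_succ_le fun n => ?_
  induction n generalizing x with
  | zero =>
    have := hL.exitRate_nonneg x
    simp only [resolventIter]
    rw [div_le_iff₀ (by linarith)]
    linarith [hLV x]
  | succ n ih =>
    have := hL.exitRate_nonneg x
    exact div_le_div_of_nonneg_right (hL.add_exitRate_mul_mono ih x) (by linarith)

/-- The decreasing limit is a fixed point of `(q + L) / (λ + q)`, that is `L u = λ u`, because `L`
is a finite sum at each point and passes to pointwise limits. -/
lemma tendsto_resolventIter {lam c : ℝ} (hlam : 0 < lam) (hc : c < lam) {V W : S → ℝ}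
    (hV : ∀ x, 0 ≤ V x) (hLV : ∀ x, L V x ≤ lam * V x) (hW : ∀ x, 0 < W x)
    (hLW : ∀ x, L W x ≤ c * W x) (hfin : ∀ K, {x | W x ≤ K * V x}.Finite) (x : S) :
    Filter.Tendsto (fun n => resolventIter L lam V n x) Filter.atTop (nhds 0) := by
  have hbdd : ∀ x, BddBelow (Set.range fun n => resolventIter L lam V n x) := fun x =>
    ⟨0, by rintro _ ⟨n, rfl⟩; exact hL.resolventIter_nonneg hlam hV n x⟩
  have hlim : ∀ x, Filter.Tendsto (fun n => resolventIter L lam V n x) Filter.atTop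
      (nhds (⨅ n, resolventIter L lam V n x)) := fun x =>
    tendsto_atTop_ciInf (hL.resolventIter_antitone hlam hLV x) (hbdd x)
  set u : S → ℝ := fun x => ⨅ n, resolventIter L lam V n x with hu
  have hLu : ∀ x, L u x = lam * u x := by
    intro x
    have hpos : 0 < lam + exitRate L x := by linarith [hL.exitRate_nonneg x]
    have h1 : Filter.Tendsto (fun n => L (resolventIter L lam V n) x) Filter.atTop
        (nhds (L u x)) := by
      simp only [hL.eq_sum]
      exact tendsto_finsetSum _ fun i _ => ((hlim _).sub (hlim _)).const_mul _
    have h2 : Filter.Tendsto (fun n => resolventIter L lam V (n + 1) x) Filter.atTop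
        (nhds ((exitRate L x * u x + L u x) / (lam + exitRate L x))) :=
      (((hlim x).const_mul _).add h1).div_const _
    have h3 := tendsto_nhds_unique h2 ((hlim x).comp (Filter.tendsto_add_atTop_nat 1))
    rw [div_eq_iff hpos.ne'] at h3
    change exitRate L x * u x + L u x = u x * _ at h3
    linarith
  have h0 := hL.eq_zero_of_harmonic hc
    (fun x => le_ciInf fun n => hL.resolventIter_nonneg hlam hV n x)
    (fun x => ciInf_le (hbdd x) 0) hLu hW hLW hfin x
  have := hlim x
  rwa [show (⨅ n, resolventIter L lam V n x) = 0 from h0] at this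

variable [Countable S]

/-- Duhamel: formally `kᵢ(t) - P_t kᵢ(0)` integrates the source `kᵢ' - L kᵢ`, so ordered sources
give ordered differences. The statement is additive because `ℝ≥0∞` has no true subtraction; the last
term pays for truncating the number of jumps. -/
lemma add_approxSemigroup_le {lam C T : ℝ} (hlam : 0 < lam) (hC : 0 ≤ C) {V : S → ℝ}
    (hV : ∀ x, 0 ≤ V x) {k₁ k₁' k₂ k₂' : ℝ → S → ℝ}
    (hk₁ : ∀ t x, HasDerivAt (fun u => k₁ u x) (k₁' t x) t)
    (hk₂ : ∀ t x, HasDerivAt (fun u => k₂ u x) (k₂' t x) t)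
    (hc₁ : ∀ x, Continuous fun t => k₁' t x) (hc₂ : ∀ x, Continuous fun t => k₂' t x)
    (hn₁ : ∀ t ∈ Set.Icc 0 T, ∀ x, 0 ≤ k₁ t x) (hn₂ : ∀ t ∈ Set.Icc 0 T, ∀ x, 0 ≤ k₂ t x)
    (hs₁ : ∀ t ∈ Set.Icc 0 T, ∀ x, L (k₁ t) x ≤ k₁' t x)
    (hs₂ : ∀ t ∈ Set.Icc 0 T, ∀ x, k₁' t x - L (k₁ t) x ≤ k₂' t x - L (k₂ t) x)
    (hle : ∀ t ∈ Set.Icc 0 T, ∀ x, k₁ t x ≤ C * Real.exp (lam * t) * V x) (n : ℕ)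
    {t : ℝ} (ht : t ∈ Set.Icc 0 T) (x : S) :
    ENNReal.ofReal (k₁ t x) + approxSemigroup L n t (fun y => ENNReal.ofReal (k₂ 0 y)) x ≤
      ENNReal.ofReal (k₂ t x) + approxSemigroup L n t (fun y => ENNReal.ofReal (k₁ 0 y)) x +
        ENNReal.ofReal (C * Real.exp (lam * t) * resolventIter L lam V n x) := by
  induction n generalizing t x with
  | zero =>
    simp only [approxSemigroup, transitionApprox, zero_mul, tsum_zero, add_zero]
    exact (ENNReal.ofReal_le_ofReal (hle t ht x)).trans le_add_self
  | succ n ih =>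
    set q := exitRate L x with hq
    have hq0 : 0 ≤ q := hL.exitRate_nonneg x
    have h0 : (0 : ℝ) ∈ Set.Icc 0 T := ⟨le_rfl, ht.1.trans ht.2⟩
    have hsub : ∀ {s}, s ∈ Set.Icc 0 t → s ∈ Set.Icc 0 T := fun hs => ⟨hs.1, hs.2.trans ht.2⟩
    have hrn := fun n y => hL.resolventIter_nonneg hlam hV n y
    have hs₂' : ∀ s ∈ Set.Icc 0 T, L (k₂ s) x ≤ k₂' s x := fun s hs => by
      linarith [hs₁ s hs x, hs₂ s hs x]
    have e₁ := ofReal_eq_add_lintegral (q := q) ht.1 (fun u => hk₁ u x) (hc₁ x) (hn₁ 0 h0 x)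
      (fun s hs => by
        linarith [hs₁ s (hsub hs) x, hL.add_exitRate_mul_nonneg (hn₁ s (hsub hs)) x])
    have e₂ := ofReal_eq_add_lintegral (q := q) ht.1 (fun u => hk₂ u x) (hc₂ x) (hn₂ 0 h0 x)
      (fun s hs => by
        linarith [hs₂' s (hsub hs), hL.add_exitRate_mul_nonneg (hn₂ s (hsub hs)) x])
    -- The denominator `lam + q` in `resolventIter` is made for this: the error term at stage `n +
    -- 1` is driven exactly by `q + L` applied to the one at stage `n`.
    have hqr : ∀ u, q * (C * Real.exp (lam * u) * resolventIter L lam V (n + 1) x) +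
        C * (Real.exp (lam * u) * (lam * 1)) * resolventIter L lam V (n + 1) x =
        q * (C * Real.exp (lam * u) * resolventIter L lam V n x) +
          L (fun y => C * Real.exp (lam * u) * resolventIter L lam V n y) x := by
      intro u
      have : resolventIter L lam V (n + 1) x * (lam + q) =
          q * resolventIter L lam V n x + L (resolventIter L lam V n) x := by
        rw [resolventIter, div_mul_cancel₀]
        positivity
      rw [hL.map_const_mul]
      linear_combination (C * Real.exp (lam * u)) * this
    have e₃ := ofReal_eq_add_lintegral (q := q) ht.1
      (k := fun u => C * Real.exp (lam * u) * resolventIter L lam V (n + 1) x)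
      (fun u => (((((hasDerivAt_id u).const_mul lam).exp).const_mul C).mul_const _))
      (by fun_prop) (by have := hrn (n + 1) x; positivity)
      (fun u _ => by
        simp only [id]
        rw [hqr u]
        exact hL.add_exitRate_mul_nonneg
          (f := fun y => C * Real.exp (lam * u) * resolventIter L lam V n y)
          (fun y => by have := hrn n y; positivity) x)
    simp only [id] at e₃
    simp only [hqr] at e₃
    rw [hL.approxSemigroup_succ, hL.approxSemigroup_succ, e₁, e₂]
    set K₁ : S → ℝ≥0∞ := fun y => ENNReal.ofReal (k₁ 0 y) with hK₁
    set K₂ : S → ℝ≥0∞ := fun y => ENNReal.ofReal (k₂ 0 y) with hK₂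
    set E : ℝ → ℝ≥0∞ := fun s => ENNReal.ofReal (Real.exp (-(q * s))) with hE
    have hEm : Measurable E := measurable_expDecay q
    have hsg : ∀ F : S → ℝ≥0∞, Measurable fun s =>
        E s * jumpOp r φ (approxSemigroup L n (t - s) F) x := fun F =>
      hEm.mul (measurable_jumpOp (F := fun s => approxSemigroup L n (t - s) F)
        (fun z => (hL.measurable_approxSemigroup n F z).comp
          (measurable_const.sub measurable_id)) x)
    -- The no-jump terms with `k₁ 0 x` and `k₂ 0 x` occur on both sides, so only the integrals are
    -- compared: sources by `hs₂`, jump parts by induction.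
    have key : (∫⁻ s in Set.Icc 0 t, E s * ENNReal.ofReal (q * k₁ (t - s) x + k₁' (t - s) x)) +
          ∫⁻ s in Set.Icc 0 t, E s * jumpOp r φ (approxSemigroup L n (t - s) K₂) x ≤
        (∫⁻ s in Set.Icc 0 t, E s * ENNReal.ofReal (q * k₂ (t - s) x + k₂' (t - s) x)) +
          (∫⁻ s in Set.Icc 0 t, E s * jumpOp r φ (approxSemigroup L n (t - s) K₁) x) +
          ∫⁻ s in Set.Icc 0 t, E s * ENNReal.ofReal
            (q * (C * Real.exp (lam * (t - s)) * resolventIter L lam V n x) +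
              L (fun y => C * Real.exp (lam * (t - s)) * resolventIter L lam V n y) x) := by
      have hm₂ : Measurable fun s => E s * ENNReal.ofReal (q * k₂ (t - s) x + k₂' (t - s) x) := by
        refine hEm.mul (Continuous.measurable ?_).ennreal_ofReal
        have h1 : Continuous fun s => k₂ s x :=
          continuous_iff_continuousAt.2 fun u => (hk₂ u x).continuousAt
        have h2 := hc₂ x
        have h3 : Continuous fun s : ℝ => t - s := by fun_prop
        exact ((h1.comp h3).const_mul q).add (h2.comp h3)
      rw [← lintegral_add_right _ (hsg K₂), ← lintegral_add_right _ (hsg K₁),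
        ← lintegral_add_left
        (f := fun s => E s * ENNReal.ofReal (q * k₂ (t - s) x + k₂' (t - s) x) +
          E s * jumpOp r φ (approxSemigroup L n (t - s) K₁) x) (hm₂.add (hsg K₁))]
      refine setLIntegral_mono' measurableSet_Icc fun s hs => ?_
      have hts : t - s ∈ Set.Icc 0 T := hsub ⟨sub_nonneg.2 hs.2, by linarith [hs.1]⟩
      rw [← mul_add, ← mul_add, ← mul_add]
      refine mul_le_mul' le_rfl ?_
      have split : ∀ k k' : ℝ → S → ℝ, (∀ y, 0 ≤ k (t - s) y) → L (k (t - s)) x ≤ k' (t - s) x →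
          ENNReal.ofReal (q * k (t - s) x + k' (t - s) x) =
            ENNReal.ofReal (k' (t - s) x - L (k (t - s)) x) +
              jumpOp r φ (fun y => ENNReal.ofReal (k (t - s) y)) x := by
        intro k k' h1 h2
        rw [← hL.ofReal_add_exitRate_mul h1, ← ENNReal.ofReal_add (sub_nonneg.2 h2)
          (hL.add_exitRate_mul_nonneg h1 x)]
        congr 1
        ring
      rw [split k₁ k₁' (hn₁ _ hts) (hs₁ _ hts x), split k₂ k₂' (hn₂ _ hts) (hs₂' _ hts),
        hL.ofReal_add_exitRate_mul
          (f := fun y => C * Real.exp (lam * (t - s)) * resolventIter L lam V n y)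
          (fun y => by have := hrn n y; positivity),
        add_assoc, add_assoc, add_assoc, ← jumpOp_add, ← jumpOp_add, ← jumpOp_add]
      refine add_le_add (ENNReal.ofReal_le_ofReal (hs₂ _ hts x)) (jumpOp_mono (fun y => ?_) x)
      rw [← add_assoc]
      exact ih hts y
    refine (add_add_add_comm _ _ _ _).trans_le ((add_le_add le_rfl key).trans ?_)
    refine le_trans (le_of_eq ?_) (add_le_add le_rfl (e₃.symm ▸ le_add_self))
    abel

end IsJumpForm

end Chain

/-! ### Binomial transform and single-site duality functions -/

section SingleSite

/-- The binomial transform `k ↦ ∑ l, (k choose l) (-θ) ^ (k - l) f l`, that is `exp (-θ K) f` for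
the single-site annihilation operator `K`. -/
def binomialTransform (θ : ℝ) : (ℕ → ℝ) → ℕ → ℝ
  | f, 0 => f 0
  | f, k + 1 => binomialTransform θ (fun l => f (l + 1)) k - θ * binomialTransform θ f k

variable (θ : ℝ)

lemma binomialTransform_succ (f : ℕ → ℝ) (k : ℕ) :
    binomialTransform θ f (k + 1) =
      binomialTransform θ (fun l => f (l + 1)) k - θ * binomialTransform θ f k := rfl

lemma binomialTransform_congr {f g : ℕ → ℝ} {k : ℕ} (h : ∀ l ≤ k, f l = g l) :
    binomialTransform θ f k = binomialTransform θ g k := by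
  induction k generalizing f g with
  | zero => exact h 0 le_rfl
  | succ k ih =>
    rw [binomialTransform, binomialTransform, ih fun l hl => h l (by omega),
      ih fun l hl => h (l + 1) (by omega)]

lemma binomialTransform_add (f g : ℕ → ℝ) (k : ℕ) :
    binomialTransform θ (fun l => f l + g l) k =
      binomialTransform θ f k + binomialTransform θ g k := by
  induction k generalizing f g with
  | zero => rfl
  | succ k ih =>
    rw [binomialTransform_succ, ih (fun l => f (l + 1)) (fun l => g (l + 1)), ih f g,
      binomialTransform_succ, binomialTransform_succ]
    ring

lemma binomialTransform_const_mul (c : ℝ) (f : ℕ → ℝ) (k : ℕ) :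
    binomialTransform θ (fun l => c * f l) k = c * binomialTransform θ f k := by
  induction k generalizing f with
  | zero => rfl
  | succ k ih =>
    rw [binomialTransform_succ, ih fun l => f (l + 1), ih f, binomialTransform_succ]
    ring

lemma binomialTransform_succ_mul (f : ℕ → ℝ) (k : ℕ) :
    binomialTransform θ (fun l => ((l + 1 : ℕ) : ℝ) * f l) k =
      binomialTransform θ (fun l => l * f l) k + binomialTransform θ f k := by
  rw [← binomialTransform_add]
  congr 1
  ext l
  push_cast
  ring

/-- With `N` the multiplication by `k`, `[K, N] = -K` gives `e^{-θK} N e^{θK} = N + θK`. -/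
lemma binomialTransform_mul (f : ℕ → ℝ) (k : ℕ) :
    binomialTransform θ (fun l => l * f l) k =
      k * binomialTransform θ f k + θ * (k * binomialTransform θ f (k - 1)) := by
  induction k generalizing f with
  | zero => simp [binomialTransform]
  | succ k ih =>
    rw [binomialTransform_succ, binomialTransform_succ_mul θ (fun l => f (l + 1)), ih f,
      ih fun l => f (l + 1), binomialTransform_succ θ f k, Nat.add_sub_cancel]
    cases k with
    | zero => simp
    | succ k =>
      have h := binomialTransform_succ θ f k
      rw [Nat.add_sub_cancel]
      push_cast
      linear_combination (-(k + 1) * θ) * h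

/-- The transform is an exponential of `K`, hence commutes with it. -/
lemma binomialTransform_mul_sub_one (f : ℕ → ℝ) (k : ℕ) :
    binomialTransform θ (fun l => l * f (l - 1)) k = k * binomialTransform θ f (k - 1) := by
  induction k generalizing f with
  | zero => simp [binomialTransform]
  | succ k ih =>
    rw [binomialTransform_succ]
    simp only [Nat.add_sub_cancel]
    rw [binomialTransform_succ_mul, binomialTransform_mul, ih]
    push_cast
    ring

lemma binomialTransform_eq_sum (f : ℕ → ℝ) (k : ℕ) :
    binomialTransform θ f k =
      ∑ l ∈ Finset.range (k + 1), (k.choose l : ℝ) * ((-θ) ^ (k - l) * f l) := by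
  induction k generalizing f with
  | zero => simp [binomialTransform]
  | succ k ih =>
    rw [Finset.sum_choose_succ_mul (fun i j => (-θ) ^ j * f i), binomialTransform_succ,
      ih fun l => f (l + 1), ih f, Finset.mul_sum, sub_eq_add_neg, ← Finset.sum_neg_distrib, add_comm]
    congr 1
    refine Finset.sum_congr rfl fun l hl => ?_
    rw [Nat.succ_sub (Nat.lt_succ_iff.1 (Finset.mem_range.1 hl)), pow_succ]
    ring

lemma hasDerivAt_binomialTransform (f : ℕ → ℝ) (k : ℕ) :
    HasDerivAt (fun ϑ => binomialTransform ϑ f k) (-(k * binomialTransform θ f (k - 1))) θ := by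
  induction k generalizing f with
  | zero => simpa [binomialTransform] using hasDerivAt_const θ (f 0)
  | succ k ih =>
    refine ((ih fun l => f (l + 1)).sub ((hasDerivAt_id θ).mul (ih f))).congr_deriv ?_
    rw [Nat.add_sub_cancel, id]
    cases k with
    | zero => simp
    | succ k =>
      rw [Nat.add_sub_cancel, binomialTransform]
      push_cast
      ring

lemma binomialTransform_zero (f : ℕ → ℝ) (k : ℕ) : binomialTransform 0 f k = f k := by
  induction k generalizing f with
  | zero => rfl
  | succ k ih => rw [binomialTransform, ih, zero_mul, sub_zero]

/-! ### Recurrences for the single-site functions. -/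

variable {σ : SignType} {a k n : ℕ}

lemma weight_succ (hk : σ = -1 → k ≤ a) :
    (weight σ a (k + 1) : ℝ) = (a + σ * k) * weight σ a k := by
  cases σ with
  | zero => simp [weight, pow_succ, mul_comm]
  | neg =>
    have hk := hk rfl
    simp only [weight, Nat.descFactorial_succ]
    push_cast [Nat.cast_sub hk]
    simp [sub_eq_add_neg]
  | pos =>
    simp only [weight, Nat.ascFactorial_succ]
    push_cast
    simp

lemma weight_pos (ha : 0 < a) (hk : σ = -1 → k ≤ a) : (0 : ℝ) < weight σ a k := by
  cases σ with
  | zero => simp only [weight]; positivity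
  | neg => simp only [weight]; exact_mod_cast (Nat.descFactorial_pos).2 (hk rfl)
  | pos => 
    simp only [weight]
    exact_mod_cast (Nat.pow_succ_le_ascFactorial a k).trans_lt' (by positivity)

lemma descFactorial_succ_cast (n k : ℕ) :
    (n.descFactorial (k + 1) : ℝ) = (n - k) * n.descFactorial k := by
  rw [Nat.descFactorial_succ]
  rcases le_or_gt k n with h | h
  · push_cast [Nat.cast_sub h]
    ring
  · simp [Nat.descFactorial_of_lt h]

lemma mul_classicalSite_pred :
    (n : ℝ) * classicalSite σ a k (n - 1) = (n - k) * classicalSite σ a k n := by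
  cases n with
  | zero =>
    cases k with
    | zero => simp
    | succ k => simp [classicalSite]
  | succ n =>
    have h : ((n + 1 : ℕ) : ℝ) * n.descFactorial k = ((n + 1 : ℕ) - k) * (n + 1).descFactorial k := by
      rw [← descFactorial_succ_cast, Nat.succ_descFactorial_succ]
      push_cast
      rfl
    rw [Nat.add_sub_cancel, classicalSite, classicalSite, ← mul_div_assoc, h, mul_div_assoc]

lemma mul_classicalSite_succ (ha : 0 < a) (hk : σ = -1 → k ≤ a) (hn : σ = -1 → n ≤ a) :
    (a + σ * k : ℝ) * classicalSite σ a (k + 1) n = (n - k) * classicalSite σ a k n := by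
  have hw := weight_pos ha hk
  rw [classicalSite, classicalSite, weight_succ hk, descFactorial_succ_cast]
  -- The coefficient vanishes only for exclusion at `k = a`, where the next weight is zero. The
  -- right side vanishes too: `n < a` kills the falling factorial and `n = a` kills `n - k`.
  by_cases h : (a + σ * k : ℝ) = 0
  · have hσ : σ = -1 ∧ k = a := by
      cases σ with
      | zero => simp at h; omega
      | pos =>
        simp at h
        have : (0 : ℝ) < a := by exact_mod_cast ha
        have : (0 : ℝ) ≤ k := by positivity
        linarith
      | neg =>
        simp at h
        refine ⟨rfl, ?_⟩
        have : (k : ℝ) = a := by linarith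
        exact_mod_cast this
    rw [h, zero_mul]
    rcases (hn hσ.1).lt_or_eq with h1 | h1
    · rw [Nat.descFactorial_of_lt (hσ.2 ▸ h1)]
      simp
    · rw [h1, hσ.2]
      simp
  · field_simp

lemma mul_classicalSite_sub (ha : 0 < a) (hk : σ = -1 → k ≤ a) :
    (a + σ * n : ℝ) * (classicalSite σ a k (n + 1) - classicalSite σ a k n) =
      k * classicalSite σ a (k - 1) n + σ * (k * classicalSite σ a k n) := by
  cases k with
  | zero => simp [classicalSite]
  | succ k =>
    have hk' : σ = -1 → k ≤ a := fun h => (Nat.le_succ k).trans (hk h)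
    have hw := weight_pos ha hk'
    have hw1 := weight_pos ha hk
    have h0 : (a + σ * k : ℝ) ≠ 0 := by
      intro h
      rw [weight_succ hk', h, zero_mul] at hw1
      exact lt_irrefl _ hw1
    have h1 : ((n + 1).descFactorial (k + 1) : ℝ) = (n + 1) * n.descFactorial k := by
      rw [Nat.succ_descFactorial_succ]
      push_cast
      rfl
    rw [Nat.add_sub_cancel]
    simp only [classicalSite]
    rw [h1, weight_succ hk', descFactorial_succ_cast]
    push_cast
    field_simp
    ring

/-- The orthogonal single-site function, written as a binomial transform. -/
noncomputable def transformedSite (σ : SignType) (θ : ℝ) (a k n : ℕ) : ℝ :=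
  binomialTransform θ (fun l => classicalSite σ a l n) k

lemma ascPochhammer_eval_neg_natCast (a l : ℕ) :
    (ascPochhammer ℝ l).eval (-(a : ℝ)) = (-1) ^ l * a.descFactorial l := by
  rw [ascPochhammer_eval_neg_eq_descPochhammer, descPochhammer_eval_eq_descFactorial]

lemma orthogonalSite_eq (ha : 0 < a) :
    orthogonalSite σ θ a k n = transformedSite σ θ a k n := by
  unfold orthogonalSite transformedSite
  split_ifs with h
  · rw [h, binomialTransform_zero]
  · rw [binomialTransform_eq_sum]
    have ha' : (a : ℝ) ≠ 0 := by exact_mod_cast ha.ne'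
    have hpow : ∀ l ∈ Finset.range (k + 1), (-θ) ^ k = (-θ) ^ (k - l) * (-θ) ^ l := fun l hl => by
      rw [← pow_add, Nat.sub_add_cancel (Nat.lt_succ_iff.1 (Finset.mem_range.1 hl))]
    cases σ with
    | zero =>
      simp only [hyp20, Finset.mul_sum]
      refine Finset.sum_congr rfl fun l hl => ?_
      have h1 : (-θ) ^ l * (-(1 / (θ * a))) ^ l = 1 / (a : ℝ) ^ l := by
        rw [← mul_pow, ← one_div_pow]
        congr 1
        field_simp
      simp only [classicalSite, weight]
      rw [hpow l hl]
      push_cast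
      linear_combination ((-θ) ^ (k - l) * (k.choose l : ℝ) * n.descFactorial l) * h1
    | neg =>
      simp only [hyp21, Finset.mul_sum]
      refine Finset.sum_congr rfl fun l hl => ?_
      have h1 : (-θ) ^ l * (1 / θ) ^ l = (-1) ^ l := by
        rw [← mul_pow]
        congr 1
        field_simp
      have h2 : (-1 : ℝ) ^ l * (-1) ^ l = 1 := by rw [← mul_pow]; simp
      have h3 : (n.descFactorial l : ℝ) / ((-1) ^ l * a.descFactorial l) =
          (-1) ^ l * (n.descFactorial l / a.descFactorial l) := by
        rw [div_mul_eq_div_div, div_eq_mul_inv (n.descFactorial l : ℝ), inv_eq_of_mul_eq_one_left h2]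
        ring
      simp only [classicalSite, weight, ascPochhammer_eval_neg_natCast, h3]
      rw [hpow l hl]
      linear_combination ((-θ) ^ (k - l) * (k.choose l : ℝ) * (-1) ^ l *
        (n.descFactorial l / a.descFactorial l)) * h1 +
        ((-θ) ^ (k - l) * (k.choose l : ℝ) * (n.descFactorial l / a.descFactorial l)) * h2
    | pos =>
      simp only [hyp21, Finset.mul_sum]
      refine Finset.sum_congr rfl fun l hl => ?_
      have h1 : (-θ) ^ l * (-(1 / θ)) ^ l = 1 := by
        rw [← mul_pow]
        have : -θ * -(1 / θ) = 1 := by field_simp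
        rw [this, one_pow]
      have h2 : (ascPochhammer ℝ l).eval (a : ℝ) = a.ascFactorial l := by
        rw [← ascPochhammer_eval_cast, ascPochhammer_nat_eq_ascFactorial]
      simp only [classicalSite, weight, h2]
      rw [hpow l hl]
      linear_combination ((-θ) ^ (k - l) * (k.choose l : ℝ) *
        (n.descFactorial l / a.ascFactorial l)) * h1

/-- Transform of `mul_classicalSite_sub`; the factor `1 + σ θ` appears because `N` becomes `N + θK`.
-/
lemma transformedSite_sub (ha : 0 < a) (hk : σ = -1 → k ≤ a) :
    (a + σ * n : ℝ) * (transformedSite σ θ a k (n + 1) - transformedSite σ θ a k n) =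
      (1 + σ * θ) * (k * transformedSite σ θ a (k - 1) n) +
        σ * (k * transformedSite σ θ a k n) := by
  have h := binomialTransform_congr θ (k := k)
    (f := fun l => (a + σ * n : ℝ) * (classicalSite σ a l (n + 1) + -1 * classicalSite σ a l n))
    (g := fun l => l * classicalSite σ a (l - 1) n + σ * (l * classicalSite σ a l n))
    (fun l hl => by
      rw [← mul_classicalSite_sub ha fun h => hl.trans (hk h)]
      ring)
  rw [binomialTransform_const_mul,
    binomialTransform_add θ (fun l => classicalSite σ a l (n + 1)),
    binomialTransform_const_mul, binomialTransform_add θ (fun l => (l : ℝ) * _),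
    binomialTransform_const_mul, binomialTransform_mul θ (fun l => classicalSite σ a l n),
    binomialTransform_mul_sub_one θ (fun l => classicalSite σ a l n)] at h
  unfold transformedSite
  linear_combination h

lemma mul_transformedSite_pred :
    (n : ℝ) * transformedSite σ θ a k (n - 1) =
      n * transformedSite σ θ a k n - k * transformedSite σ θ a k n -
        θ * (k * transformedSite σ θ a (k - 1) n) := by
  have h := binomialTransform_congr θ (k := k)
    (f := fun l => (n : ℝ) * classicalSite σ a l (n - 1))
    (g := fun l => n * classicalSite σ a l n + -1 * (l * classicalSite σ a l n))
    (fun l _ => by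
      rw [mul_classicalSite_pred]
      ring)
  rw [binomialTransform_const_mul, binomialTransform_add θ (fun l => (n : ℝ) * _),
    binomialTransform_const_mul, binomialTransform_const_mul, binomialTransform_mul] at h
  unfold transformedSite
  linear_combination h

/-- Transform of `mul_classicalSite_succ`: `N` times the shift becomes `(N + θK)` times `(shift +
θ)`, which produces the coefficient `2 σ k` and the `θ ^ 2` term. -/
lemma mul_transformedSite_succ (ha : 0 < a) (hk : σ = -1 → k ≤ a) (hn : σ = -1 → n ≤ a) :
    (a + σ * k : ℝ) * transformedSite σ θ a (k + 1) n +
        θ * (a + 2 * σ * k) * transformedSite σ θ a k n +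
        θ ^ 2 * σ * (k * transformedSite σ θ a (k - 1) n) =
      n * transformedSite σ θ a k (n - 1) := by
  have h := binomialTransform_congr θ (k := k)
    (f := fun l => a * classicalSite σ a (l + 1) n + σ * (l * classicalSite σ a (l + 1) n))
    (g := fun l => (n : ℝ) * classicalSite σ a l (n - 1))
    (fun l hl => by
      rw [mul_classicalSite_pred, ← mul_classicalSite_succ ha (fun h => hl.trans (hk h)) hn]
      ring)
  rw [binomialTransform_add θ (fun l => (a : ℝ) * _), binomialTransform_const_mul,
    binomialTransform_const_mul, binomialTransform_const_mul,
    binomialTransform_mul θ (fun l => classicalSite σ a (l + 1) n)] at h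
  unfold transformedSite
  rw [← h, binomialTransform_succ]
  cases k with
  | zero => simp; ring
  | succ k =>
    have h' := binomialTransform_succ θ (fun l => classicalSite σ a l n) k
    rw [Nat.add_sub_cancel]
    push_cast
    linear_combination (σ * θ * (k + 1)) * h'

/-- Polynomial bound on the single-site functions. -/
lemma abs_transformedSite_le (ha : 0 < a) (hk : σ = -1 → k ≤ a) :
    ∃ C, 0 ≤ C ∧ ∀ n : ℕ, |transformedSite σ θ a k n| ≤ C * (n + 1 : ℝ) ^ k := by
  refine ⟨∑ l ∈ Finset.range (k + 1), (k.choose l : ℝ) * |(-θ) ^ (k - l)| / weight σ a l,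
    by positivity, fun n => ?_⟩
  rw [transformedSite, binomialTransform_eq_sum, Finset.sum_mul]
  refine (Finset.abs_sum_le_sum_abs _ _).trans (Finset.sum_le_sum fun l hl => ?_)
  have hl' := Nat.lt_succ_iff.1 (Finset.mem_range.1 hl)
  have hw := weight_pos ha fun h => hl'.trans (hk h)
  have h1 : (n.descFactorial l : ℝ) ≤ (n + 1 : ℝ) ^ k :=
    calc (n.descFactorial l : ℝ) ≤ (n : ℝ) ^ l := by exact_mod_cast Nat.descFactorial_le_pow n l
      _ ≤ (n + 1 : ℝ) ^ l := by gcongr; linarith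
      _ ≤ (n + 1 : ℝ) ^ k := by
        gcongr
        have : (0 : ℝ) ≤ n := by positivity
        linarith
  rw [classicalSite, abs_mul, abs_mul, abs_div, Nat.abs_cast, Nat.abs_cast, Nat.abs_cast,
    div_mul_eq_mul_div, ← mul_div_assoc, ← mul_div_assoc, mul_assoc]
  gcongr

end SingleSite

/-! ### The law of the chain and the backward equation -/

section Law

variable {S : Type*} {ι : Type*} [Fintype ι] {L : (S → ℝ) → S → ℝ} {r : ι → S → ℝ}
  {φ : ι → S → S}

namespace IsJumpForm

variable [Countable S] (hL : IsJumpForm L r φ)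
include hL

omit [Countable S] in
lemma monotone_approxSemigroup (t : ℝ) (F : S → ℝ≥0∞) (x : S) :
    Monotone fun n => approxSemigroup L n t F x := fun _ _ hmn =>
  ENNReal.tsum_le_tsum fun y => mul_le_mul' (hL.monotone_transitionApprox t x y hmn) le_rfl

lemma lintegral_lawAt [MeasurableSpace S] [DiscreteMeasurableSpace S] (t : ℝ≥0) (F : S → ℝ≥0∞)
    (x : S) : ∫⁻ y, F y ∂(lawAt L x t) = ⨆ n, approxSemigroup L n t F x := by
  have h1 : ∫⁻ y, F y ∂(lawAt L x t) = ∑' y, ⨆ n, transitionApprox L n t x y * F y := by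
    rw [lawAt, lintegral_sum_measure]
    refine tsum_congr fun y => ?_
    rw [lintegral_smul_measure, lintegral_dirac, transition, smul_eq_mul, ENNReal.iSup_mul]
  have h2 : ∀ n, approxSemigroup L n t F x =
      ∫⁻ y, transitionApprox L n t x y * F y ∂Measure.count := fun n => (lintegral_count _).symm
  simp only [h2]
  rw [h1, ← lintegral_count, lintegral_iSup (fun n => Measurable.of_discrete)]
  exact fun m n hmn y => mul_le_mul' (hL.monotone_transitionApprox t x y hmn) le_rfl

omit hL [Countable S] [Fintype ι] in
lemma add_iSup_le_of_tendsto {a b : ℝ≥0∞} {F G : ℕ → ℝ≥0∞} {u : ℕ → ℝ} (hF : Monotone F)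
    (hu : Filter.Tendsto u Filter.atTop (nhds 0))
    (h : ∀ n, a + F n ≤ b + G n + ENNReal.ofReal (u n)) : a + ⨆ n, F n ≤ b + ⨆ n, G n := by
  rw [ENNReal.add_iSup]
  refine iSup_le fun m => ?_
  have hlim : Filter.Tendsto (fun n => b + (⨆ n, G n) + ENNReal.ofReal (u n)) Filter.atTop
      (nhds (b + (⨆ n, G n) + ENNReal.ofReal 0)) :=
    tendsto_const_nhds.add (ENNReal.tendsto_ofReal hu)
  rw [ENNReal.ofReal_zero, add_zero] at hlim
  refine ge_of_tendsto hlim ?_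
  filter_upwards [Filter.eventually_ge_atTop m] with n hn
  calc a + F m ≤ a + F n := by gcongr; exact hF hn
    _ ≤ b + G n + ENNReal.ofReal (u n) := h n
    _ ≤ _ := by gcongr; exact le_iSup G n

/-- A solution of the backward equation dominated by `V` is given by the minimal transition
function, provided that `V` and `W` are Lyapunov functions and `V / W` vanishes at infinity. -/
theorem integral_lawAt_eq [MeasurableSpace S] [DiscreteMeasurableSpace S] {lam c C T : ℝ}
    (hlam : 0 < lam) (hc : c < lam) (hC : 0 ≤ C) {V W : S → ℝ} (hV : ∀ x, 0 ≤ V x)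
    (hLV : ∀ x, L V x ≤ lam * V x) (hW : ∀ x, 0 < W x) (hLW : ∀ x, L W x ≤ c * W x)
    (hfin : ∀ K, {x | W x ≤ K * V x}.Finite) {h : ℝ → S → ℝ}
    (hh : ∀ t x, HasDerivAt (fun u => h u x) (L (h t) x) t)
    (hb : ∀ t ∈ Set.Icc 0 T, ∀ x, |h t x| ≤ C * V x) {t : ℝ≥0} (ht : (t : ℝ) ≤ T) (x : S) :
    Integrable (h 0) (lawAt L x t) ∧ ∫ y, h 0 y ∂(lawAt L x t) = h t x := by
  -- The supersolution `k` dominates `|h|`, so `g = h + k` is nonnegative, and `g` and `k` have the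
  -- same source since `h` has none.
  set k : ℝ → S → ℝ := fun u y => C * Real.exp (lam * u) * V y with hk
  set k' : ℝ → S → ℝ := fun u y => C * (Real.exp (lam * u) * lam) * V y with hk'
  set g : ℝ → S → ℝ := fun u y => h u y + k u y with hg
  set g' : ℝ → S → ℝ := fun u y => L (h u) y + k' u y with hg'
  have htT : (t : ℝ) ∈ Set.Icc 0 T := ⟨t.2, ht⟩
  have hkd : ∀ u y, HasDerivAt (fun u => k u y) (k' u y) u := fun u y => by
    have := ((((hasDerivAt_id u).const_mul lam).exp).const_mul C).mul_const (V y)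
    simpa [hk, hk'] using this
  have hgd : ∀ u y, HasDerivAt (fun u => g u y) (g' u y) u := fun u y => (hh u y).add (hkd u y)
  have hkc : ∀ y, Continuous fun u => k' u y := fun y => by simp only [hk']; fun_prop
  have hhc : ∀ y, Continuous fun u => h u y := fun y =>
    continuous_iff_continuousAt.2 fun u => (hh u y).continuousAt
  have hgc : ∀ y, Continuous fun u => g' u y := fun y => by
    refine Continuous.add ?_ (hkc y)
    simp only [hL.eq_sum]
    exact continuous_finsetSum _ fun i _ => ((hhc _).sub (hhc _)).const_mul _
  have hkn : ∀ u ∈ Set.Icc 0 T, ∀ y, 0 ≤ k u y := fun u _ y => by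
    have := hV y
    simp only [hk]
    positivity
  have hle : ∀ u ∈ Set.Icc 0 T, ∀ y, |h u y| ≤ k u y := fun u hu y => by
    refine (hb u hu y).trans (mul_le_mul_of_nonneg_right ?_ (hV y))
    exact le_mul_of_one_le_right hC (Real.one_le_exp (mul_nonneg hlam.le hu.1))
  have hgn : ∀ u ∈ Set.Icc 0 T, ∀ y, 0 ≤ g u y := fun u hu y => by
    have := neg_abs_le (h u y)
    have := hle u hu y
    simp only [hg]
    linarith
  have hks : ∀ u ∈ Set.Icc 0 T, ∀ y, L (k u) y ≤ k' u y := fun u _ y => by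
    simp only [hk, hk']
    rw [hL.map_const_mul]
    have : 0 ≤ C * Real.exp (lam * u) := by positivity
    nlinarith [mul_le_mul_of_nonneg_left (hLV y) this]
  have hsrc : ∀ u y, g' u y - L (g u) y = k' u y - L (k u) y := fun u y => by
    simp only [hg, hg', hL.map_add]
    ring
  have hgs : ∀ u ∈ Set.Icc 0 T, ∀ y, L (g u) y ≤ g' u y := fun u hu y => by
    linarith [hks u hu y, hsrc u y]
  have htend : ∀ D : ℝ, Filter.Tendsto (fun n => D * Real.exp (lam * t) * resolventIter L lam V n x)
      Filter.atTop (nhds 0) := fun D => by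
    simpa using (hL.tendsto_resolventIter hlam hc hV hLV hW hLW hfin x).const_mul
      (D * Real.exp (lam * t))
  -- Equal sources allow the comparison both ways, giving `g(t) + P k(0) = k(t) + P g(0)`. The
  -- constant is `2 * C` here because `g ≤ 2 k`.
  have i₁ := add_iSup_le_of_tendsto (hL.monotone_approxSemigroup _ _ x) (htend (2 * C)) fun n =>
    hL.add_approxSemigroup_le hlam (by positivity) hV hgd hkd hgc hkc hgn hkn hgs
      (fun u _ y => (hsrc u y).le)
      (fun u hu y => by
        have := (le_abs_self _).trans (hle u hu y)
        simp only [hg, hk] at this ⊢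
        linarith) n htT x
  have i₂ := add_iSup_le_of_tendsto (hL.monotone_approxSemigroup _ _ x) (htend C) fun n =>
    hL.add_approxSemigroup_le hlam hC hV hkd hgd hkc hgc hkn hgn hks
      (fun u _ y => (hsrc u y).ge) (fun u _ y => le_rfl) n htT x
  -- Comparing zero with `k` gives `P k(0) ≤ k(t)`, the finiteness needed before subtracting.
  have i₃ := add_iSup_le_of_tendsto (hL.monotone_approxSemigroup _ _ x) (htend 0) fun n =>
    hL.add_approxSemigroup_le (k₁ := fun _ _ => 0) (k₁' := fun _ _ => 0) hlam le_rfl hV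
      (fun u _ => hasDerivAt_const u (0 : ℝ)) hkd (fun _ => continuous_const) hkc
      (fun _ _ _ => le_rfl) hkn (fun _ _ y => (hL.map_const 0 y).le)
      (fun u hu y => by rw [hL.map_const, sub_self]; exact sub_nonneg.2 (hks u hu y))
      (fun u _ y => by simp) n htT x
  simp only [← hL.lintegral_lawAt] at i₁ i₂ i₃
  simp only [ENNReal.ofReal_zero, zero_add, lintegral_const, zero_mul, add_zero] at i₃
  have heq := le_antisymm i₁ i₂
  have h0T : (0 : ℝ) ∈ Set.Icc 0 T := ⟨le_rfl, htT.1.trans htT.2⟩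
  have hkfin : ∫⁻ y, ENNReal.ofReal (k 0 y) ∂(lawAt L x t) ≠ ⊤ :=
    (i₃.trans_lt ENNReal.ofReal_lt_top).ne
  have hgfin : ∫⁻ y, ENNReal.ofReal (g 0 y) ∂(lawAt L x t) ≠ ⊤ := by
    refine ne_top_of_le_ne_top ?_ (le_add_self.trans i₂)
    exact ENNReal.add_ne_top.2 ⟨ENNReal.ofReal_ne_top, hkfin⟩
  have hint : ∀ f : S → ℝ, (∀ y, 0 ≤ f y) → ∫⁻ y, ENNReal.ofReal (f y) ∂(lawAt L x t) ≠ ⊤ →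
      Integrable f (lawAt L x t) ∧
        ∫ y, f y ∂(lawAt L x t) = (∫⁻ y, ENNReal.ofReal (f y) ∂(lawAt L x t)).toReal := by
    intro f hf hfi
    have hm : AEStronglyMeasurable f (lawAt L x t) := Measurable.of_discrete.aestronglyMeasurable
    refine ⟨⟨hm, ?_⟩, integral_eq_lintegral_of_nonneg_ae (Filter.Eventually.of_forall hf) hm⟩
    rw [hasFiniteIntegral_iff_ofReal (Filter.Eventually.of_forall hf)]
    exact hfi.lt_top
  obtain ⟨gi, ge⟩ := hint (g 0) (hgn 0 h0T) hgfin
  obtain ⟨ki, ke⟩ := hint (k 0) (hkn 0 h0T) hkfin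
  have hsub : h 0 = fun y => g 0 y - k 0 y := by
    ext y
    simp only [hg]
    ring
  have hreal := congrArg ENNReal.toReal heq
  rw [ENNReal.toReal_add ENNReal.ofReal_ne_top hkfin, ENNReal.toReal_add ENNReal.ofReal_ne_top hgfin,
    ENNReal.toReal_ofReal (hgn _ htT x), ENNReal.toReal_ofReal (hkn _ htT x), ← ge, ← ke] at hreal
  refine ⟨hsub ▸ gi.sub ki, ?_⟩
  rw [hsub, integral_sub gi ki]
  simp only [hg] at hreal ⊢
  linarith

/-- Non-explosion under a Lyapunov condition. -/
theorem isProbabilityMeasure_lawAt [MeasurableSpace S] [DiscreteMeasurableSpace S] {c : ℝ}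
    {W : S → ℝ} (hW : ∀ x, 0 < W x) (hLW : ∀ x, L W x ≤ c * W x)
    (hfin : ∀ K, {x | W x ≤ K}.Finite) (t : ℝ≥0) (x : S) :
    IsProbabilityMeasure (lawAt L x t) := by
  obtain ⟨hi, he⟩ := hL.integral_lawAt_eq (lam := max c 0 + 1) (c := c) (C := 1) (T := t)
    (V := fun _ => 1) (h := fun _ _ => 1) (by positivity)
    ((le_max_left _ _).trans_lt (lt_add_one _)) zero_le_one (fun _ => zero_le_one)
    (fun y => by rw [hL.map_const]; positivity) hW hLW (fun K => by simpa using hfin K)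
    (fun u y => by rw [hL.map_const]; exact hasDerivAt_const u 1) (fun _ _ _ => by simp) le_rfl x
  have : IsFiniteMeasure (lawAt L x t) := by
    rw [integrable_const_iff] at hi
    exact hi.resolve_left one_ne_zero
  refine ⟨?_⟩
  rw [integral_const, smul_eq_mul, mul_one, measureReal_def] at he
  rwa [ENNReal.toReal_eq_one_iff] at he

end IsJumpForm

lemma IsMarkovChain.map_eq [Countable S] [MeasurableSpace S] [DiscreteMeasurableSpace S]
    {Ω : Type*} [MeasurableSpace Ω] {P : Measure Ω} {X : ℝ≥0 → Ω → S} {x : S}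
    (hX : IsMarkovChain L P X x) (t : ℝ≥0) : P.map (X t) = lawAt L x t := by
  have := hX.isProbabilityMeasure
  have h0 : ∀ᵐ ω ∂P, X 0 ω = x := by
    have h := hX.finite_dim 0 (fun _ => 0) (fun _ => x) monotone_const rfl rfl
    simp only [nonpos_iff_eq_zero, forall_eq, Finset.range_zero, Finset.prod_empty] at h
    change P (X 0 ⁻¹' {x}) = 1 at h
    rw [← prob_compl_eq_zero_iff (hX.measurable 0 (measurableSet_singleton x))] at h
    exact h
  refine Measure.ext_of_singleton fun y => ?_
  rw [Measure.map_apply (hX.measurable t) (measurableSet_singleton y)]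
  -- Times `0, t, t, …`: finite-dimensional laws always fix the starting point, a condition that is
  -- almost sure by `h0`.
  have h := hX.finite_dim 1 (fun i => if i = 0 then 0 else t) (fun i => if i = 0 then x else y)
    (monotone_nat_of_le_succ fun n => by cases n <;> simp) rfl rfl
  have hset : {ω | ∀ i ≤ 1, X (if i = 0 then 0 else t) ω = if i = 0 then x else y} =
      {ω | X 0 ω = x ∧ X t ω = y} := by
    ext ω
    refine ⟨fun h => ⟨by simpa using h 0 zero_le_one, by simpa using h 1 le_rfl⟩, ?_⟩
    rintro ⟨h1, h2⟩ i hi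
    interval_cases i <;> simpa
  rw [hset] at h
  have hae : P (X t ⁻¹' {y}) = P {ω | X 0 ω = x ∧ X t ω = y} := by
    refine measure_congr ?_
    filter_upwards [h0] with ω hω
    exact propext ⟨fun h => ⟨hω, h⟩, fun h => h.2⟩
  rw [hae, h, lawAt, Measure.sum_apply _ (measurableSet_singleton y),
    tsum_eq_single y (fun z hz => by simp [hz])]
  simp

end Law

/-! ### Building generators from elementary jumps -/

section HasJumpForm

variable {S : Type*}

/-- `L` is the generator of a chain with finitely many kinds of jumps. -/
def HasJumpForm (L : (S → ℝ) → S → ℝ) : Prop :=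
  ∃ (ι : Type) (_ : Fintype ι) (r : ι → S → ℝ) (φ : ι → S → S), IsJumpForm L r φ

lemma HasJumpForm.single {ρ : S → ℝ} (hρ : ∀ x, 0 ≤ ρ x) (ψ : S → S) :
    HasJumpForm fun f x => ρ x * (f (ψ x) - f x) :=
  ⟨Unit, inferInstance, fun _ => ρ, fun _ => ψ, fun _ => hρ, fun f x => by simp⟩

lemma HasJumpForm.zero : HasJumpForm fun (_ : S → ℝ) _ => 0 :=
  ⟨Empty, inferInstance, fun i => i.elim, fun i => i.elim, fun i => i.elim, fun f x => by simp⟩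

lemma HasJumpForm.add {L M : (S → ℝ) → S → ℝ} (hL : HasJumpForm L) (hM : HasJumpForm M) :
    HasJumpForm fun f x => L f x + M f x := by
  obtain ⟨ι, _, r, φ, hL⟩ := hL
  obtain ⟨κ, _, s, ψ, hM⟩ := hM
  refine ⟨ι ⊕ κ, inferInstance, Sum.elim r s, Sum.elim φ ψ, ?_, fun f x => ?_⟩
  · rintro (i | i) x
    exacts [hL.nonneg i x, hM.nonneg i x]
  · simp [hL.eq_sum, hM.eq_sum]

lemma HasJumpForm.const_mul {L : (S → ℝ) → S → ℝ} (hL : HasJumpForm L) {c : ℝ} (hc : 0 ≤ c) :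
    HasJumpForm fun f x => c * L f x := by
  obtain ⟨ι, _, r, φ, hL⟩ := hL
  refine ⟨ι, inferInstance, fun i x => c * r i x, φ, fun i x => mul_nonneg hc (hL.nonneg i x),
    fun f x => ?_⟩
  simp [hL.eq_sum, Finset.mul_sum, mul_assoc]

lemma HasJumpForm.sum {κ : Type*} (s : Finset κ) {L : κ → (S → ℝ) → S → ℝ}
    (hL : ∀ k ∈ s, HasJumpForm (L k)) : HasJumpForm fun f x => ∑ k ∈ s, L k f x := by
  classical
  induction s using Finset.induction_on with
  | empty => simpa using HasJumpForm.zero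
  | insert k s hk ih =>
    simp only [Finset.sum_insert hk]
    exact (hL k (Finset.mem_insert_self k s)).add
      (ih fun j hj => hL j (Finset.mem_insert_of_mem hj))

end HasJumpForm

section Model

variable {σ : SignType} {N : ℕ} (p : Params σ N)

/-! ### Moves of configurations -/

/-- Number of particles. -/
def Config.size {p : Params σ N} (η : Config p) : ℕ := ∑ x, η.1 x

/-- Number of particles, including those at `L` and `R`. -/
def dualSize {p : Params σ N} (ξ : DualConfig p) : ℕ := ξ.1.size + ξ.2.1 + ξ.2.2

variable {p}

lemma Config.le_size (η : Config p) (x : Fin (N + 1)) : η.1 x ≤ η.size :=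
  Finset.single_le_sum (f := η.1) (fun _ _ => Nat.zero_le _) (Finset.mem_univ x)

lemma Config.rate_nonneg (η : Config p) (x : Fin (N + 1)) : 0 ≤ (p.α x + σ * η.1 x : ℝ) := by
  cases σ with
  | zero => simp
  | pos => simp; positivity
  | neg =>
    simp
    exact η.2 rfl x

/-- A move is refused only when its target site `y` is full, and then its rate is zero; the fallback
value of `moveTo` is therefore immaterial. -/
lemma Config.moveTo_val_or (η : Config p) {η' : Fin (N + 1) → ℕ} {y : Fin (N + 1)}
    (h : ∀ z, η' z ≤ η.1 z + (Pi.single y 1 : Fin (N + 1) → ℕ) z) :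
    (η.moveTo η').1 = η' ∨ (η.moveTo η' = η ∧ (p.α y + σ * η.1 y : ℝ) = 0) := by
  unfold Config.moveTo
  split_ifs with hadm
  · exact Or.inl rfl
  · refine Or.inr ⟨rfl, ?_⟩
    push Not at hadm
    obtain ⟨hσ, z, hz⟩ := hadm
    have h1 := h z
    have h2 := η.2 hσ z
    have hzy : z = y := by
      by_contra hne
      rw [Pi.single_eq_of_ne hne] at h1
      omega
    subst hzy
    rw [Pi.single_eq_same] at h1
    have h3 : η.1 z = p.α z := by omega
    subst hσ
    simp [h3]

lemma Config.hop_val_or (η : Config p) (x y : Fin (N + 1)) :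
    (η.hop x y).1 = η.1 - Pi.single x 1 + Pi.single y 1 ∨
      (η.hop x y = η ∧ (p.α y + σ * η.1 y : ℝ) = 0) :=
  η.moveTo_val_or fun z => by simp only [Pi.add_apply, Pi.sub_apply]; omega

lemma Config.insert_val_or (η : Config p) (x : Fin (N + 1)) :
    (η.insert x).1 = η.1 + Pi.single x 1 ∨
      (η.insert x = η ∧ (p.α x + σ * η.1 x : ℝ) = 0) :=
  η.moveTo_val_or fun z => by simp only [Pi.add_apply]; omega

lemma Config.remove_val (η : Config p) (x : Fin (N + 1)) :
    (η.remove x).1 = η.1 - Pi.single x 1 := by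
  unfold Config.remove Config.moveTo
  rw [dif_pos]
  intro h z
  exact (Nat.sub_le _ _).trans (η.2 h z)

lemma Config.rate_mul_hop (η : Config p) (x y : Fin (N + 1)) (F : (Fin (N + 1) → ℕ) → ℝ) :
    (η.1 x * (p.α y + σ * η.1 y) : ℝ) * (F (η.hop x y).1 - F η.1) =
      (η.1 x * (p.α y + σ * η.1 y) : ℝ) * (F (η.1 - Pi.single x 1 + Pi.single y 1) - F η.1) := by
  rcases η.hop_val_or x y with h | ⟨-, h⟩
  · rw [h]
  · rw [h]; ring

lemma Config.rate_mul_insert (η : Config p) (x : Fin (N + 1)) (F : (Fin (N + 1) → ℕ) → ℝ) :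
    (p.α x + σ * η.1 x : ℝ) * (F (η.insert x).1 - F η.1) =
      (p.α x + σ * η.1 x : ℝ) * (F (η.1 + Pi.single x 1) - F η.1) := by
  rcases η.insert_val_or x with h | ⟨-, h⟩
  · rw [h]
  · rw [h]; ring

lemma sum_add_single (k : Fin (N + 1) → ℕ) (x : Fin (N + 1)) :
    ∑ z, (k + Pi.single x 1 : Fin (N + 1) → ℕ) z = ∑ z, k z + 1 := by
  simp [Finset.sum_add_distrib]

lemma sum_sub_single {k : Fin (N + 1) → ℕ} {x : Fin (N + 1)} (h : k x ≠ 0) :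
    ∑ z, (k - Pi.single x 1 : Fin (N + 1) → ℕ) z + 1 = ∑ z, k z := by
  rw [← sum_add_single _ x]
  congr 1
  ext z
  by_cases hz : z = x
  · subst hz
    simp
    omega
  · simp [hz]

lemma Config.size_hop (η : Config p) {x : Fin (N + 1)} (hx : η.1 x ≠ 0) (y : Fin (N + 1)) :
    (η.hop x y).size = η.size := by
  rcases η.hop_val_or x y with h | ⟨h, -⟩
  · rw [Config.size, h, sum_add_single, sum_sub_single hx, Config.size]
  · rw [h]

lemma Config.size_remove (η : Config p) {x : Fin (N + 1)} (hx : η.1 x ≠ 0) :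
    (η.remove x).size + 1 = η.size := by
  rw [Config.size, η.remove_val, sum_sub_single hx, Config.size]

lemma Config.size_remove_le (η : Config p) (x : Fin (N + 1)) : (η.remove x).size ≤ η.size := by
  rw [Config.size, η.remove_val]
  exact Finset.sum_le_sum fun z _ => Nat.sub_le _ _

lemma Config.size_insert_le (η : Config p) (x : Fin (N + 1)) :
    (η.insert x).size ≤ η.size + 1 := by
  rcases η.insert_val_or x with h | ⟨h, -⟩
  · rw [Config.size, h, sum_add_single, Config.size]
  · rw [h]; exact Nat.le_succ _

lemma finite_size_le (K : ℕ) : {η : Config p | η.size ≤ K}.Finite := by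
  refine ((Set.finite_Iic fun _ : Fin (N + 1) => K).preimage
    Subtype.val_injective.injOn).subset fun η hη x => (Config.le_size η x).trans hη

lemma finite_dualSize_le (K : ℕ) : {ξ : DualConfig p | dualSize ξ ≤ K}.Finite := by
  refine ((finite_size_le K).prod ((Set.finite_Iic K).prod (Set.finite_Iic K))).subset
    fun ξ hξ => ?_
  simp only [dualSize, Set.mem_ofPred_eq] at hξ
  simp only [Set.mem_prod, Set.mem_ofPred_eq, Set.mem_Iic]
  omega

/-! ### The generators -/

/-- `π` and `ins` let one argument serve both chains: trivial for the driven system, and with the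
reservoir counts frozen for the dual. -/
lemma HasJumpForm.bulk {S : Type*} {π : S → Config p} {ins : S → Config p → S}
    (h : ∀ s, ins s (π s) = s) :
    HasJumpForm fun f s => bulkGen p (fun ζ => f (ins s ζ)) (π s) := by
  unfold bulkGen bondGen
  refine HasJumpForm.sum _ fun x _ => HasJumpForm.sum _ fun y _ =>
    HasJumpForm.const_mul ?_ (p.ω_nonneg x y)
  simp only [h]
  exact (HasJumpForm.single (fun s => mul_nonneg (Nat.cast_nonneg _) ((π s).rate_nonneg y))
    fun s => ins s ((π s).hop x y)).add
    (HasJumpForm.single (fun s => mul_nonneg (Nat.cast_nonneg _) ((π s).rate_nonneg x))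
      fun s => ins s ((π s).hop y x))

lemma scale_nonneg {ϑ : ℝ} (h : ϑ ∈ scaleSet σ) : 0 ≤ ϑ ∧ 0 ≤ 1 + σ * ϑ := by
  unfold scaleSet at h
  cases σ with
  | zero => simpa using h
  | pos =>
    have : 0 ≤ ϑ := by simpa using h
    simp
    constructor <;> linarith
  | neg =>
    have h : ϑ ∈ Set.Icc (0 : ℝ) 1 := by simpa using h
    simp
    exact h

lemma HasJumpForm.reservoir {a ϑ : ℝ} (ha : 0 < a) (h : ϑ ∈ scaleSet σ) (x : Fin (N + 1)) :
    HasJumpForm (reservoirGen p a ϑ x) := by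
  obtain ⟨h1, h2⟩ := scale_nonneg h
  refine (HasJumpForm.single (fun η => ?_) _).add (HasJumpForm.single (fun η => ?_) _)
  · have : a + σ * a * ϑ = a * (1 + σ * ϑ) := by ring
    rw [this]
    positivity
  · have := η.rate_nonneg x
    positivity

variable (p) in
lemma hasJumpForm_gen : HasJumpForm (gen p) :=
  (HasJumpForm.bulk (π := id) (ins := fun _ ζ => ζ) fun _ => rfl).add
    (((HasJumpForm.reservoir p.αL_pos p.θL_mem _).const_mul p.ωL_nonneg).add
      ((HasJumpForm.reservoir p.αR_pos p.θR_mem _).const_mul p.ωR_nonneg))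

variable (p) in
lemma hasJumpForm_dualGen : HasJumpForm (dualGen p) := by
  have hL := p.αL_pos
  have hR := p.αR_pos
  exact (HasJumpForm.bulk (π := Prod.fst) (ins := fun ξ ζ => (ζ, ξ.2)) fun _ => rfl).add
    (((HasJumpForm.single (fun ξ => by positivity) _).const_mul p.ωL_nonneg).add
      ((HasJumpForm.single (fun ξ => by positivity) _).const_mul p.ωR_nonneg))

/-- Jumps from an empty site have rate zero, so truncated subtraction never breaks particle
conservation. -/
lemma bulkGen_congr {f g : Config p → ℝ} {η : Config p}
    (h : ∀ ζ : Config p, ζ.size = η.size → f ζ = g ζ) : bulkGen p f η = bulkGen p g η := by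
  have key : ∀ x y, (η.1 x : ℝ) * (p.α y + σ * η.1 y) * (f (η.hop x y) - f η) =
      η.1 x * (p.α y + σ * η.1 y) * (g (η.hop x y) - g η) := by
    intro x y
    by_cases hx : η.1 x = 0
    · simp [hx]
    · rw [h _ (η.size_hop hx y), h η rfl]
  simp only [bulkGen, bondGen, key]

lemma dualGen_congr {f g : DualConfig p → ℝ} {ξ : DualConfig p}
    (h : ∀ ζ : DualConfig p, dualSize ζ = dualSize ξ → f ζ = g ζ) :
    dualGen p f ξ = dualGen p g ξ := by
  have hbulk : bulkGen p (fun ζ => f (ζ, ξ.2)) ξ.1 = bulkGen p (fun ζ => g (ζ, ξ.2)) ξ.1 :=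
    bulkGen_congr fun ζ hζ => h _ (by simp [dualSize, hζ])
  have hL : (ξ.1.1 0 : ℝ) * (f (ξ.1.remove 0, ξ.2.1 + 1, ξ.2.2) - f ξ) =
      ξ.1.1 0 * (g (ξ.1.remove 0, ξ.2.1 + 1, ξ.2.2) - g ξ) := by
    by_cases hx : ξ.1.1 0 = 0
    · simp [hx]
    · rw [h ξ rfl, h]
      have := ξ.1.size_remove hx
      simp only [dualSize]
      omega
  have hR : (ξ.1.1 (Fin.last N) : ℝ) * (f (ξ.1.remove (Fin.last N), ξ.2.1, ξ.2.2 + 1) - f ξ) =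
      ξ.1.1 (Fin.last N) * (g (ξ.1.remove (Fin.last N), ξ.2.1, ξ.2.2 + 1) - g ξ) := by
    by_cases hx : ξ.1.1 (Fin.last N) = 0
    · simp [hx]
    · rw [h ξ rfl, h]
      have := ξ.1.size_remove hx
      simp only [dualSize]
      omega
  rw [dualGen, dualGen, hbulk, mul_assoc, mul_assoc, mul_assoc, mul_assoc, hL, hR]

lemma bulkGen_size (G : ℕ → ℝ) (η : Config p) : bulkGen p (fun ζ => G ζ.size) η = 0 := by
  rw [bulkGen_congr (g := fun _ => G η.size) fun ζ hζ => by rw [hζ]]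
  simp [bulkGen, bondGen]

lemma dualGen_dualSize (G : ℕ → ℝ) (ξ : DualConfig p) :
    dualGen p (fun ζ => G (dualSize ζ)) ξ = 0 := by
  rw [dualGen_congr (g := fun _ => G (dualSize ξ)) fun ζ hζ => by rw [hζ]]
  simp [dualGen, bulkGen, bondGen]

/-! ### Lyapunov functions of the boundary driven system -/

/-- The Lyapunov function `(n + 1) (n + 2) ⋯ (n + m)`, for `n` particles. -/
def lyapunov (m n : ℕ) : ℝ := (n + 1).ascFactorial m

lemma lyapunov_pos (m n : ℕ) : 0 < lyapunov m n := by
  unfold lyapunov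
  exact_mod_cast Nat.ascFactorial_pos n m

/-- The reason for rising factorials instead of powers: the injection rate is at most linear in `n +
1`, and `n + 1` times the increment is exactly a multiple of the function. -/
lemma lyapunov_succ_right (m n : ℕ) :
    (n + 1 : ℝ) * (lyapunov m (n + 1) - lyapunov m n) = m * lyapunov m n := by
  have h : ((n + 1 : ℕ) : ℝ) * lyapunov m (n + 1) = ((n + 1 + m : ℕ) : ℝ) * lyapunov m n := by
    unfold lyapunov
    exact_mod_cast Nat.succ_ascFactorial (n + 1) m
  push_cast at h
  linarith

lemma lyapunov_succ_left (m n : ℕ) : lyapunov (m + 1) n = (n + 1 + m) * lyapunov m n := by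
  rw [lyapunov, Nat.ascFactorial_succ, lyapunov]
  push_cast
  ring

lemma lyapunov_mono (m : ℕ) : Monotone (lyapunov m) := by
  refine monotone_nat_of_le_succ fun n => ?_
  have h := lyapunov_succ_right m n
  have h1 : 0 ≤ m * lyapunov m n := mul_nonneg (Nat.cast_nonneg _) (lyapunov_pos m n).le
  rw [← h] at h1
  have := nonneg_of_mul_nonneg_right h1 (by positivity)
  linarith

lemma reservoirGen_lyapunov_le {a ϑ : ℝ} (ha : 0 < a) (h : ϑ ∈ scaleSet σ) (x : Fin (N + 1))
    (m : ℕ) (η : Config p) :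
    reservoirGen p a ϑ x (fun ζ => lyapunov m ζ.size) η ≤
      a * ϑ * p.α x * m * lyapunov m η.size := by
  obtain ⟨h1, h2⟩ := scale_nonneg h
  have hout : (η.1 x : ℝ) * (a + σ * a * ϑ) *
      (lyapunov m (η.remove x).size - lyapunov m η.size) ≤ 0 := by
    refine mul_nonpos_of_nonneg_of_nonpos ?_
      (sub_nonpos.2 (lyapunov_mono m (η.size_remove_le x)))
    have : a + σ * a * ϑ = a * (1 + σ * ϑ) := by ring
    rw [this]
    positivity
  have hrate : (p.α x + σ * η.1 x : ℝ) ≤ p.α x * (η.size + 1) := by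
    have hα : (1 : ℝ) ≤ p.α x := by exact_mod_cast p.α_pos x
    have hs : (η.1 x : ℝ) ≤ η.size := by exact_mod_cast η.le_size x
    have hσ : (σ : ℝ) * η.1 x ≤ η.1 x := by
      cases σ <;> simp
    nlinarith [Nat.cast_nonneg (α := ℝ) (η.1 x)]
  have hd : lyapunov m (η.insert x).size - lyapunov m η.size ≤
      lyapunov m (η.size + 1) - lyapunov m η.size :=
    sub_le_sub_right (lyapunov_mono m (η.size_insert_le x)) _
  have hd0 : 0 ≤ lyapunov m (η.size + 1) - lyapunov m η.size :=
    sub_nonneg.2 (lyapunov_mono m (Nat.le_succ _))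
  have hin : a * ϑ * (p.α x + σ * η.1 x) *
      (lyapunov m (η.insert x).size - lyapunov m η.size) ≤
      a * ϑ * p.α x * m * lyapunov m η.size := by
    have := η.rate_nonneg x
    calc _ ≤ a * ϑ * (p.α x + σ * η.1 x) * (lyapunov m (η.size + 1) - lyapunov m η.size) := by
          gcongr
      _ ≤ a * ϑ * (p.α x * (η.size + 1)) * (lyapunov m (η.size + 1) - lyapunov m η.size) := by
          gcongr
      _ = _ := by linear_combination (a * ϑ * p.α x) * lyapunov_succ_right m η.size
  unfold reservoirGen
  linarith

variable (p) in
/-- Growth rate of the Lyapunov function `lyapunov m`. -/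
def growthRate (m : ℕ) : ℝ :=
  (p.ωL * (p.αL * p.θL * p.α 0) + p.ωR * (p.αR * p.θR * p.α (Fin.last N))) * m

lemma growthRate_nonneg (m : ℕ) : 0 ≤ growthRate p m := by
  have h1 := p.ωL_nonneg
  have h2 := p.ωR_nonneg
  have h3 := p.αL_pos
  have h4 := p.αR_pos
  have h5 := (scale_nonneg p.θL_mem).1
  have h6 := (scale_nonneg p.θR_mem).1
  unfold growthRate
  positivity

lemma gen_lyapunov_le (m : ℕ) (η : Config p) :
    gen p (fun ζ => lyapunov m ζ.size) η ≤ growthRate p m * lyapunov m η.size := by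
  have h1 := mul_le_mul_of_nonneg_left
    (reservoirGen_lyapunov_le p.αL_pos p.θL_mem 0 m η) p.ωL_nonneg
  have h2 := mul_le_mul_of_nonneg_left
    (reservoirGen_lyapunov_le p.αR_pos p.θR_mem (Fin.last N) m η) p.ωR_nonneg
  rw [gen, bulkGen_size, growthRate]
  linarith

lemma finite_lyapunov_succ_le (m : ℕ) (K : ℝ) :
    {η : Config p | lyapunov (m + 1) η.size ≤ K * lyapunov m η.size}.Finite := by
  refine (finite_size_le ⌊K⌋₊).subset fun η hη => ?_
  have hη : lyapunov (m + 1) η.size ≤ K * lyapunov m η.size := hη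
  rw [lyapunov_succ_left] at hη
  have := le_of_mul_le_mul_right hη (lyapunov_pos m _)
  refine Nat.le_floor ?_
  have hm : (0 : ℝ) ≤ m := Nat.cast_nonneg m
  linarith

end Model

section Duality

variable {σ : SignType} {N : ℕ} {p : Params σ N}

/-! ### Duality of the generators -/

variable (p) in
/-- The bulk part of the orthogonal duality function. -/
noncomputable def siteProd (θ : ℝ) (k n : Fin (N + 1) → ℕ) : ℝ :=
  ∏ x, transformedSite σ θ (p.α x) (k x) (n x)

lemma orthogonalDuality_eq (θ : ℝ) (ξ : DualConfig p) (η : Config p) :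
    orthogonalDuality p θ ξ η =
      (p.θL - θ) ^ ξ.2.1 * siteProd p θ ξ.1.1 η.1 * (p.θR - θ) ^ ξ.2.2 := by
  simp only [orthogonalDuality, siteProd, orthogonalSite_eq θ (p.α_pos _)]

lemma siteProd_update_one (θ : ℝ) (k n : Fin (N + 1) → ℕ) (x : Fin (N + 1)) :
    ∃ R : ℝ, ∀ k' n' : Fin (N + 1) → ℕ, (∀ z ≠ x, k' z = k z) → (∀ z ≠ x, n' z = n z) →
      siteProd p θ k' n' = transformedSite σ θ (p.α x) (k' x) (n' x) * R := by
  refine ⟨∏ z ∈ Finset.univ.erase x, transformedSite σ θ (p.α z) (k z) (n z),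
    fun k' n' hk hn => ?_⟩
  rw [siteProd, ← Finset.mul_prod_erase _ _ (Finset.mem_univ x)]
  congr 1
  refine Finset.prod_congr rfl fun z hz => ?_
  rw [hk z (Finset.ne_of_mem_erase hz), hn z (Finset.ne_of_mem_erase hz)]

lemma siteProd_update_two (θ : ℝ) (k n : Fin (N + 1) → ℕ) {x y : Fin (N + 1)} (hxy : x ≠ y) :
    ∃ R : ℝ, ∀ k' n' : Fin (N + 1) → ℕ, (∀ z, z ≠ x → z ≠ y → k' z = k z) →
      (∀ z, z ≠ x → z ≠ y → n' z = n z) →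
      siteProd p θ k' n' = transformedSite σ θ (p.α x) (k' x) (n' x) *
        transformedSite σ θ (p.α y) (k' y) (n' y) * R := by
  refine ⟨∏ z ∈ (Finset.univ.erase x).erase y, transformedSite σ θ (p.α z) (k z) (n z),
    fun k' n' hk hn => ?_⟩
  rw [siteProd, ← Finset.mul_prod_erase _ _ (Finset.mem_univ x), ← Finset.mul_prod_erase
    (Finset.univ.erase x) _ (Finset.mem_erase.2 ⟨hxy.symm, Finset.mem_univ y⟩), mul_assoc]
  congr 2
  refine Finset.prod_congr rfl fun z hz => ?_
  have hy := Finset.ne_of_mem_erase hz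
  have hx := Finset.ne_of_mem_erase (Finset.mem_of_mem_erase hz)
  rw [hk z hx hy, hn z hx hy]

lemma siteProd_bond (θ : ℝ) (ξ η : Config p) {x y : Fin (N + 1)} (hxy : x ≠ y) :
    (ξ.1 x * (p.α y + σ * ξ.1 y) : ℝ) *
          (siteProd p θ (ξ.1 - Pi.single x 1 + Pi.single y 1) η.1 - siteProd p θ ξ.1 η.1) +
        (ξ.1 y * (p.α x + σ * ξ.1 x) : ℝ) *
          (siteProd p θ (ξ.1 - Pi.single y 1 + Pi.single x 1) η.1 - siteProd p θ ξ.1 η.1) =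
      (η.1 x * (p.α y + σ * η.1 y) : ℝ) *
          (siteProd p θ ξ.1 (η.1 - Pi.single x 1 + Pi.single y 1) - siteProd p θ ξ.1 η.1) +
        (η.1 y * (p.α x + σ * η.1 x) : ℝ) *
          (siteProd p θ ξ.1 (η.1 - Pi.single y 1 + Pi.single x 1) - siteProd p θ ξ.1 η.1) := by
  obtain ⟨R, hR⟩ := siteProd_update_two (p := p) θ ξ.1 η.1 hxy
  have hmove : ∀ (k : Fin (N + 1) → ℕ) (u v : Fin (N + 1)), ∀ z, z ≠ u → z ≠ v →
      (k - Pi.single u 1 + Pi.single v 1 : Fin (N + 1) → ℕ) z = k z := by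
    intro k u v z hu hv
    simp [hu, hv]
  have hrefl : ∀ k : Fin (N + 1) → ℕ, ∀ z, z ≠ x → z ≠ y → k z = k z := fun _ _ _ _ => rfl
  rw [hR _ _ (hmove ξ.1 x y) (hrefl _), hR _ _ (hrefl ξ.1) (hrefl η.1),
    hR _ _ (fun z hx hy => hmove ξ.1 y x z hy hx) (hrefl _),
    hR _ _ (hrefl _) (hmove η.1 x y), hR _ _ (hrefl _) (fun z hx hy => hmove η.1 y x z hy hx)]
  have e1 : ∀ k : Fin (N + 1) → ℕ, (k - Pi.single x 1 + Pi.single y 1 : Fin (N + 1) → ℕ) x =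
      k x - 1 := fun k => by simp [hxy]
  have e2 : ∀ k : Fin (N + 1) → ℕ, (k - Pi.single x 1 + Pi.single y 1 : Fin (N + 1) → ℕ) y =
      k y + 1 := fun k => by simp [hxy.symm]
  have e3 : ∀ k : Fin (N + 1) → ℕ, (k - Pi.single y 1 + Pi.single x 1 : Fin (N + 1) → ℕ) x =
      k x + 1 := fun k => by simp [hxy]
  have e4 : ∀ k : Fin (N + 1) → ℕ, (k - Pi.single y 1 + Pi.single x 1 : Fin (N + 1) → ℕ) y =
      k y - 1 := fun k => by simp [hxy.symm]
  simp only [e1, e2, e3, e4]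
  have ax := mul_transformedSite_succ θ (p.α_pos x) (fun h => ξ.2 h x) (fun h => η.2 h x)
  have ay := mul_transformedSite_succ θ (p.α_pos y) (fun h => ξ.2 h y) (fun h => η.2 h y)
  have bx := mul_transformedSite_pred θ (σ := σ) (a := p.α x) (k := ξ.1 x) (n := η.1 x)
  have byy := mul_transformedSite_pred θ (σ := σ) (a := p.α y) (k := ξ.1 y) (n := η.1 y)
  have cx := transformedSite_sub θ (n := η.1 x) (p.α_pos x) (fun h => ξ.2 h x)
  have cy := transformedSite_sub θ (n := η.1 y) (p.α_pos y) (fun h => ξ.2 h y)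
  generalize transformedSite σ θ (p.α x) (ξ.1 x) (η.1 x) = dx at *
  generalize transformedSite σ θ (p.α y) (ξ.1 y) (η.1 y) = dy at *
  generalize transformedSite σ θ (p.α x) (ξ.1 x + 1) (η.1 x) = kx at *
  generalize transformedSite σ θ (p.α y) (ξ.1 y + 1) (η.1 y) = ky at *
  generalize transformedSite σ θ (p.α x) (ξ.1 x - 1) (η.1 x) = lx at *
  generalize transformedSite σ θ (p.α y) (ξ.1 y - 1) (η.1 y) = ly at *
  generalize transformedSite σ θ (p.α x) (ξ.1 x) (η.1 x - 1) = mx at *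
  generalize transformedSite σ θ (p.α y) (ξ.1 y) (η.1 y - 1) = my at *
  generalize transformedSite σ θ (p.α x) (ξ.1 x) (η.1 x + 1) = ux at *
  generalize transformedSite σ θ (p.α y) (ξ.1 y) (η.1 y + 1) = uy at *
  generalize (ξ.1 x : ℝ) = k at *
  generalize (ξ.1 y : ℝ) = l at *
  generalize (η.1 x : ℝ) = m at *
  generalize (η.1 y : ℝ) = n at *
  generalize (p.α x : ℝ) = a at *
  generalize (p.α y : ℝ) = b at *
  generalize (σ : ℝ) = s at *
  clear * - ax ay bx byy cx cy
  -- All shifted values reduce to `dx`, `dy`, `k * lx` and `l * ly`; both sides are then the same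
  -- polynomial in these.
  have key : k * lx * ((b + s * l) * ky) + l * ly * ((a + s * k) * kx) -
      (k * (b + s * l) + l * (a + s * k)) * (dx * dy) =
      m * mx * ((b + s * n) * uy) + n * my * ((a + s * m) * ux) -
      (m * (b + s * n) + n * (a + s * m)) * (dx * dy) := by
    have hkx : (a + s * k) * kx = m * mx - θ * (a + 2 * s * k) * dx - θ ^ 2 * s * (k * lx) := by
      linear_combination ax
    have hky : (b + s * l) * ky = n * my - θ * (b + 2 * s * l) * dy - θ ^ 2 * s * (l * ly) := by
      linear_combination ay
    have hux : (a + s * m) * ux =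
        (a + s * m) * dx + (1 + s * θ) * (k * lx) + s * (k * dx) := by linear_combination cx
    have huy : (b + s * n) * uy =
        (b + s * n) * dy + (1 + s * θ) * (l * ly) + s * (l * dy) := by linear_combination cy
    have hmx : m * mx = m * dx - k * dx - θ * (k * lx) := bx
    have hmy : n * my = n * dy - l * dy - θ * (l * ly) := byy
    rw [hkx, hky, hux, huy, hmx, hmy]
    ring
  linear_combination R * key

lemma bondGen_orthogonalDuality (θ : ℝ) (ξ : DualConfig p) (η : Config p) {x y : Fin (N + 1)}
    (hxy : x ≠ y) :
    bondGen p x y (fun ζ => orthogonalDuality p θ (ζ, ξ.2) η) ξ.1 =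
      bondGen p x y (fun ζ => orthogonalDuality p θ ξ ζ) η := by
  simp only [bondGen, orthogonalDuality_eq, ← sub_mul, ← mul_sub]
  have h1 := ξ.1.rate_mul_hop x y (fun k => siteProd p θ k η.1)
  have h2 := ξ.1.rate_mul_hop y x (fun k => siteProd p θ k η.1)
  have h3 := η.rate_mul_hop x y (fun k => siteProd p θ ξ.1.1 k)
  have h4 := η.rate_mul_hop y x (fun k => siteProd p θ ξ.1.1 k)
  linear_combination ((p.θL - θ) ^ ξ.2.1 * (p.θR - θ) ^ ξ.2.2) *
    (h1 + h2 - h3 - h4 + siteProd_bond θ ξ.1 η hxy)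

lemma bulkGen_orthogonalDuality (θ : ℝ) (ξ : DualConfig p) (η : Config p) :
    bulkGen p (fun ζ => orthogonalDuality p θ (ζ, ξ.2) η) ξ.1 =
      bulkGen p (fun ζ => orthogonalDuality p θ ξ ζ) η := by
  refine Finset.sum_congr rfl fun x _ => Finset.sum_congr rfl fun y hy => ?_
  rw [bondGen_orthogonalDuality θ ξ η (Finset.mem_Ioi.1 hy).ne]

lemma siteProd_reservoir (θ a ϑ : ℝ) (ξ η : Config p) (x : Fin (N + 1)) :
    a * ξ.1 x * ((ϑ - θ) * siteProd p θ (ξ.remove x).1 η.1 - siteProd p θ ξ.1 η.1) =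
      reservoirGen p a ϑ x (fun ζ => siteProd p θ ξ.1 ζ.1) η := by
  obtain ⟨R, hR⟩ := siteProd_update_one (p := p) θ ξ.1 η.1 x
  have hins := η.rate_mul_insert x (fun k => siteProd p θ ξ.1 k)
  simp only [reservoirGen, Config.remove_val]
  have hrefl : ∀ k : Fin (N + 1) → ℕ, ∀ z, z ≠ x → k z = k z := fun _ _ _ => rfl
  have hsub : ∀ k : Fin (N + 1) → ℕ, ∀ z, z ≠ x →
      (k - Pi.single x 1 : Fin (N + 1) → ℕ) z = k z := fun k z hz => by simp [hz]
  have hadd : ∀ k : Fin (N + 1) → ℕ, ∀ z, z ≠ x →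
      (k + Pi.single x 1 : Fin (N + 1) → ℕ) z = k z := fun k z hz => by simp [hz]
  rw [hR _ _ (hrefl _) (hadd η.1), hR _ _ (hrefl ξ.1) (hrefl η.1)] at hins
  rw [hR _ _ (hsub ξ.1) (hrefl _), hR _ _ (hrefl ξ.1) (hsub η.1), hR _ _ (hrefl ξ.1) (hrefl η.1)]
  simp only [Pi.sub_apply, Pi.add_apply, Pi.single_eq_same] at hins ⊢
  have b := mul_transformedSite_pred θ (σ := σ) (a := p.α x) (k := ξ.1 x) (n := η.1 x)
  have c := transformedSite_sub θ (n := η.1 x) (p.α_pos x) (fun h => ξ.2 h x)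
  linear_combination (-(a * ϑ)) * hins - (a * (1 + σ * ϑ) * R) * b - (a * ϑ * R) * c

lemma reservoirGen_mul_const (a ϑ c : ℝ) (x : Fin (N + 1)) (f : Config p → ℝ) (η : Config p) :
    reservoirGen p a ϑ x (fun ζ => c * f ζ) η = c * reservoirGen p a ϑ x f η := by
  unfold reservoirGen
  ring

/-- Duality of the generators. -/
theorem dualGen_orthogonalDuality (θ : ℝ) (ξ : DualConfig p) (η : Config p) :
    dualGen p (fun ζ => orthogonalDuality p θ ζ η) ξ =
      gen p (fun ζ => orthogonalDuality p θ ξ ζ) η := by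
  have hfac : (fun ζ => orthogonalDuality p θ ξ ζ) =
      fun ζ => ((p.θL - θ) ^ ξ.2.1 * (p.θR - θ) ^ ξ.2.2) * siteProd p θ ξ.1.1 ζ.1 := by
    ext ζ
    rw [orthogonalDuality_eq]
    ring
  rw [dualGen, gen, bulkGen_orthogonalDuality, hfac, reservoirGen_mul_const,
    reservoirGen_mul_const, ← siteProd_reservoir, ← siteProd_reservoir]
  simp only [orthogonalDuality_eq]
  ring

/-! ### The semigroup on levels of the dual system -/

lemma abs_orthogonalDuality_le (θ : ℝ) (ξ : DualConfig p) :
    ∃ C, 0 ≤ C ∧ ∀ η : Config p,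
      |orthogonalDuality p θ ξ η| ≤ C * lyapunov (dualSize ξ) η.size := by
  choose C hC0 hC using fun x => abs_transformedSite_le θ (p.α_pos x) (fun h => ξ.1.2 h x)
  refine ⟨|p.θL - θ| ^ ξ.2.1 * (∏ x, C x) * |p.θR - θ| ^ ξ.2.2, ?_, fun η => ?_⟩
  · have := Finset.prod_nonneg fun x (_ : x ∈ Finset.univ) => hC0 x
    positivity
  have h1 : |siteProd p θ ξ.1.1 η.1| ≤ (∏ x, C x) * lyapunov (dualSize ξ) η.size := by
    rw [siteProd, Finset.abs_prod]
    calc ∏ x, |transformedSite σ θ (p.α x) (ξ.1.1 x) (η.1 x)|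
        ≤ ∏ x, (C x * (η.size + 1 : ℝ) ^ ξ.1.1 x) := by
          refine Finset.prod_le_prod (fun x _ => abs_nonneg _) fun x _ => (hC x _).trans ?_
          have : (η.1 x : ℝ) ≤ η.size := by exact_mod_cast η.le_size x
          have := hC0 x
          gcongr
      _ = (∏ x, C x) * (η.size + 1 : ℝ) ^ ξ.1.size := by
          rw [Finset.prod_mul_distrib, Finset.prod_pow_eq_pow_sum]
          rfl
      _ ≤ (∏ x, C x) * lyapunov (dualSize ξ) η.size := by
          refine mul_le_mul_of_nonneg_left ?_ (Finset.prod_nonneg fun x _ => hC0 x)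
          -- The exponent is raised to `dualSize ξ` so that one Lyapunov function serves a whole
          -- level.
          calc (η.size + 1 : ℝ) ^ ξ.1.size ≤ (η.size + 1 : ℝ) ^ dualSize ξ := by
                refine pow_le_pow_right₀ (by linarith [Nat.cast_nonneg (α := ℝ) η.size]) ?_
                simp only [dualSize]
                omega
            _ ≤ _ := by
                unfold lyapunov
                exact_mod_cast Nat.pow_succ_le_ascFactorial (η.size + 1) (dualSize ξ)
  rw [orthogonalDuality_eq, abs_mul, abs_mul, abs_pow, abs_pow]
  calc _ ≤ |p.θL - θ| ^ ξ.2.1 * ((∏ x, C x) * lyapunov (dualSize ξ) η.size) *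
        |p.θR - θ| ^ ξ.2.2 := by gcongr
    _ = _ := by ring

variable (p) in
/-- The dual configurations with `m` particles. -/
abbrev Level (m : ℕ) : Type := {ξ : DualConfig p // dualSize ξ = m}

noncomputable instance (m : ℕ) : Fintype (Level p m) :=
  ((finite_dualSize_le m).subset fun _ h => le_of_eq h : {ξ : DualConfig p | dualSize ξ = m}.Finite).fintype

/-- Extension by zero of a function on a level. -/
def extendLevel {m : ℕ} (u : Level p m → ℝ) (ζ : DualConfig p) : ℝ :=
  if h : dualSize ζ = m then u ⟨ζ, h⟩ else 0

variable (p) in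
/-- The generator of the dual system on a level. -/
noncomputable def levelGen (m : ℕ) : (Level p m → ℝ) →L[ℝ] (Level p m → ℝ) :=
  LinearMap.toContinuousLinearMap
    { toFun := fun u ξ => dualGen p (extendLevel u) ξ.1
      map_add' := fun u v => by
        obtain ⟨ι, _, r, φ, h⟩ := hasJumpForm_dualGen p
        ext ξ
        rw [Pi.add_apply, ← h.map_add]
        congr 1
        ext ζ
        unfold extendLevel
        split_ifs <;> simp
      map_smul' := fun c u => by
        obtain ⟨ι, _, r, φ, h⟩ := hasJumpForm_dualGen p
        ext ξ
        rw [Pi.smul_apply, smul_eq_mul, RingHom.id_apply, ← h.map_const_mul]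
        congr 1
        ext ζ
        unfold extendLevel
        split_ifs <;> simp }

/-- Extension by zero does no harm: dual jumps stay within the level. -/
lemma levelGen_apply {m : ℕ} {u : Level p m → ℝ} {f : DualConfig p → ℝ}
    (h : ∀ ζ : Level p m, f ζ.1 = u ζ) (ξ : Level p m) : levelGen p m u ξ = dualGen p f ξ.1 := by
  refine dualGen_congr (f := extendLevel u) fun ζ hζ => ?_
  have hζ : dualSize ζ = m := hζ.trans ξ.2
  rw [extendLevel, dif_pos hζ, ← h]

variable (p) in
/-- The semigroup of the dual system on a level. -/
noncomputable def levelExp (m : ℕ) (t : ℝ) : (Level p m → ℝ) →L[ℝ] (Level p m → ℝ) :=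
  NormedSpace.exp (t • levelGen p m)

lemma continuous_levelExp (m : ℕ) : Continuous (levelExp p m) :=
  continuous_iff_continuousAt.2 fun t => (hasDerivAt_exp_smul_const (levelGen p m) t).continuousAt

lemma hasDerivAt_levelExp (m : ℕ) (u : Level p m → ℝ) (ξ : Level p m) (t : ℝ) :
    HasDerivAt (fun s => levelExp p m s u ξ) (levelExp p m t (levelGen p m u) ξ) t :=
  hasDerivAt_pi.1 ((hasDerivAt_exp_smul_const (levelGen p m) t).clm_apply
    (hasDerivAt_const t u) |>.congr_deriv (by rw [map_zero, add_zero]; rfl)) ξ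

lemma hasDerivAt_levelExp' (m : ℕ) (u : Level p m → ℝ) (ξ : Level p m) (t : ℝ) :
    HasDerivAt (fun s => levelExp p m s u ξ) (levelGen p m (levelExp p m t u) ξ) t :=
  hasDerivAt_pi.1 ((hasDerivAt_exp_smul_const' (levelGen p m) t).clm_apply
    (hasDerivAt_const t u) |>.congr_deriv (by rw [map_zero, add_zero]; rfl)) ξ

variable (p) in
/-- The duality function, evolved up to time `t`. -/
noncomputable def evolvedDuality (θ t : ℝ) (ξ : DualConfig p) (η : Config p) : ℝ :=
  levelExp p (dualSize ξ) t (fun ζ => orthogonalDuality p θ ζ.1 η) ⟨ξ, rfl⟩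

lemma evolvedDuality_eq (θ t : ℝ) (η : Config p) {m : ℕ} (ξ : Level p m) :
    evolvedDuality p θ t ξ.1 η =
      levelExp p m t (fun ζ => orthogonalDuality p θ ζ.1 η) ξ := by
  obtain ⟨ξ, rfl⟩ := ξ
  rfl

lemma evolvedDuality_zero (θ : ℝ) (ξ : DualConfig p) (η : Config p) :
    evolvedDuality p θ 0 ξ η = orthogonalDuality p θ ξ η := by
  simp [evolvedDuality, levelExp]

lemma hasDerivAt_evolvedDuality_dual (θ t : ℝ) (ξ : DualConfig p) (η : Config p) :
    HasDerivAt (fun s => evolvedDuality p θ s ξ η)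
      (dualGen p (fun ζ => evolvedDuality p θ t ζ η) ξ) t :=
  (hasDerivAt_levelExp' (dualSize ξ) _ ⟨ξ, rfl⟩ t).congr_deriv
    (levelGen_apply (fun ζ => evolvedDuality_eq θ t η ζ) _)

/-- The derivative is `e^{tA} A D` with `A` the dual generator. Duality replaces `A D` by the driven
generator in `η`, a finite linear combination of values of `D`, which the linear map `e^{tA}` passes
through. -/
lemma hasDerivAt_evolvedDuality (θ t : ℝ) (ξ : DualConfig p) (η : Config p) :
    HasDerivAt (fun s => evolvedDuality p θ s ξ η)
      (gen p (fun ζ => evolvedDuality p θ t ξ ζ) η) t := by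
  refine (hasDerivAt_levelExp (dualSize ξ) _ ⟨ξ, rfl⟩ t).congr_deriv ?_
  obtain ⟨ι, _, r, φ, h⟩ := hasJumpForm_gen p
  have hgen : levelGen p (dualSize ξ) (fun ζ => orthogonalDuality p θ ζ.1 η) =
      ∑ i, r i η • ((fun ζ : Level p (dualSize ξ) => orthogonalDuality p θ ζ.1 (φ i η)) -
        fun ζ => orthogonalDuality p θ ζ.1 η) := by
    ext ζ
    rw [levelGen_apply (f := fun ζ => orthogonalDuality p θ ζ η) (fun _ => rfl),
      dualGen_orthogonalDuality, h.eq_sum]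
    simp
  rw [hgen, h.eq_sum, map_sum, Finset.sum_apply]
  simp only [map_smul, map_sub, Pi.smul_apply, Pi.sub_apply, smul_eq_mul, evolvedDuality]

/-- The operator norm of the exponential is bounded on compact time intervals, so the growth in `η`
is that of the duality functions of the level. -/
lemma exists_evolvedDuality_le (θ T : ℝ) (m : ℕ) :
    ∃ C, 0 ≤ C ∧ ∀ t ∈ Set.Icc 0 T, ∀ (ξ : DualConfig p) (η : Config p), dualSize ξ = m →
      |evolvedDuality p θ t ξ η| ≤ C * lyapunov m η.size := by
  obtain ⟨A, hA⟩ := isCompact_Icc.exists_bound_of_continuousOn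
    ((continuous_levelExp (p := p) m).continuousOn (s := Set.Icc 0 T))
  choose B hB0 hB using fun ζ : Level p m => abs_orthogonalDuality_le θ ζ.1
  refine ⟨|A| * ∑ ζ, B ζ, mul_nonneg (abs_nonneg _) (Finset.sum_nonneg fun ζ _ => hB0 ζ), ?_⟩
  intro t ht ξ η hξ
  have hV := lyapunov_pos m η.size
  have hD : ‖fun ζ : Level p m => orthogonalDuality p θ ζ.1 η‖ ≤
      (∑ ζ, B ζ) * lyapunov m η.size := by
    rw [pi_norm_le_iff_of_nonneg
      (mul_nonneg (Finset.sum_nonneg fun ζ _ => hB0 ζ) hV.le)]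
    intro ζ
    have h1 := hB ζ η
    rw [ζ.2] at h1
    refine h1.trans (mul_le_mul_of_nonneg_right ?_ hV.le)
    exact Finset.single_le_sum (fun ζ _ => hB0 ζ) (Finset.mem_univ ζ)
  rw [evolvedDuality_eq θ t η ⟨ξ, hξ⟩, mul_assoc]
  calc _ ≤ ‖levelExp p m t (fun ζ => orthogonalDuality p θ ζ.1 η)‖ := norm_le_pi_norm _ _
    _ ≤ ‖levelExp p m t‖ * ‖fun ζ : Level p m => orthogonalDuality p θ ζ.1 η‖ :=
      ContinuousLinearMap.le_opNorm _ _
    _ ≤ _ := mul_le_mul ((hA t ht).trans (le_abs_self A)) hD (norm_nonneg _) (abs_nonneg _)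

/-! ### Duality of the laws -/

lemma integral_lawAt_gen (θ : ℝ) (ξ : DualConfig p) (η : Config p) (t : ℝ≥0) :
    Integrable (fun ζ => orthogonalDuality p θ ξ ζ) (lawAt (gen p) η t) ∧
      ∫ ζ, orthogonalDuality p θ ξ ζ ∂(lawAt (gen p) η t) = evolvedDuality p θ t ξ η := by
  obtain ⟨ι, _, r, φ, h⟩ := hasJumpForm_gen p
  obtain ⟨C, hC, hb⟩ := exists_evolvedDuality_le (p := p) θ t (dualSize ξ)
  set m := dualSize ξ with hm
  -- `growthRate` is nonnegative and linear in `m`, so the `lam` chosen above the rate of `W` also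
  -- covers `V`.
  have hle : growthRate p m ≤ growthRate p (m + 1) + 1 := by
    have h1 := growthRate_nonneg (p := p) 1
    unfold growthRate at *
    push_cast at *
    linarith
  have := h.integral_lawAt_eq (lam := growthRate p (m + 1) + 1) (c := growthRate p (m + 1))
    (C := C) (T := t) (V := fun ζ => lyapunov m ζ.size) (W := fun ζ => lyapunov (m + 1) ζ.size)
    (h := fun s ζ => evolvedDuality p θ s ξ ζ)
    (by linarith [growthRate_nonneg (p := p) (m + 1)]) (by linarith) hC
    (fun ζ => (lyapunov_pos _ _).le)
    (fun ζ => (gen_lyapunov_le m ζ).trans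
      (mul_le_mul_of_nonneg_right hle (lyapunov_pos _ _).le))
    (fun ζ => lyapunov_pos _ _) (gen_lyapunov_le (m + 1)) (finite_lyapunov_succ_le m)
    (fun s ζ => hasDerivAt_evolvedDuality θ s ξ ζ) (fun s hs ζ => hb s hs ξ ζ rfl) le_rfl η
  simpa only [evolvedDuality_zero] using this

lemma isProbabilityMeasure_lawAt_gen (η : Config p) (t : ℝ≥0) :
    IsProbabilityMeasure (lawAt (gen p) η t) := by
  obtain ⟨ι, _, r, φ, h⟩ := hasJumpForm_gen p
  refine h.isProbabilityMeasure_lawAt (fun ζ => lyapunov_pos 1 ζ.size) (gen_lyapunov_le 1)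
    (fun K => ?_) t η
  -- `lyapunov 0` is the constant `1`.
  simpa [lyapunov] using finite_lyapunov_succ_le (p := p) 0 K

lemma integral_lawAt_dualGen (θ : ℝ) (ξ : DualConfig p) (η : Config p) (t : ℝ≥0) :
    Integrable (fun ζ => orthogonalDuality p θ ζ η) (lawAt (dualGen p) ξ t) ∧
      ∫ ζ, orthogonalDuality p θ ζ η ∂(lawAt (dualGen p) ξ t) = evolvedDuality p θ t ξ η := by
  obtain ⟨ι, _, r, φ, h⟩ := hasJumpForm_dualGen p
  choose C hC hb using exists_evolvedDuality_le (p := p) θ t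
  set B : ℕ → ℝ := fun m => C m * lyapunov m η.size with hB
  have hB0 : ∀ m, 0 ≤ B m := fun m => mul_nonneg (hC m) (lyapunov_pos _ _).le
  -- Functions of the conserved `dualSize` are annihilated by the generator, so `V` can be the bound
  -- itself; in `W` the `+ 1` gives positivity and the factor `n + 1` the growth over `V`.
  have := h.integral_lawAt_eq (lam := 1) (c := 0) (C := 1) (T := t)
    (V := fun ζ => B (dualSize ζ))
    (W := fun ζ => (fun n : ℕ => (n + 1 : ℝ) * (B n + 1)) (dualSize ζ))
    (h := fun s ζ => evolvedDuality p θ s ζ η) one_pos one_pos zero_le_one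
    (fun ζ => hB0 _) (fun ζ => by rw [dualGen_dualSize, one_mul]; exact hB0 _)
    (fun ζ => by have := hB0 (dualSize ζ); positivity)
    (fun ζ => by
      rw [zero_mul]
      exact (dualGen_dualSize (fun n : ℕ => (n + 1 : ℝ) * (B n + 1)) ζ).le)
    (fun K => by
      refine (finite_dualSize_le ⌊|K|⌋₊).subset fun ζ hζ => Nat.le_floor ?_
      have hζ : (dualSize ζ + 1 : ℝ) * (B (dualSize ζ) + 1) ≤ K * B (dualSize ζ) := hζ
      have h0 := hB0 (dualSize ζ)
      have h1 : (dualSize ζ + 1 : ℝ) * (B (dualSize ζ) + 1) ≤ |K| * (B (dualSize ζ) + 1) :=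
        hζ.trans (mul_le_mul (le_abs_self K) (by linarith) h0 (abs_nonneg K))
      have h2 := le_of_mul_le_mul_right h1 (by linarith)
      linarith)
    (fun s ζ => hasDerivAt_evolvedDuality_dual θ s ζ η)
    (fun s hs ζ => by rw [one_mul]; exact hb _ s hs ζ η rfl) le_rfl ξ
  simpa only [evolvedDuality_zero] using this

lemma isProbabilityMeasure_lawAt_dualGen (ξ : DualConfig p) (t : ℝ≥0) :
    IsProbabilityMeasure (lawAt (dualGen p) ξ t) := by
  obtain ⟨ι, _, r, φ, h⟩ := hasJumpForm_dualGen p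
  refine h.isProbabilityMeasure_lawAt (c := 0)
    (W := fun ζ => (fun n : ℕ => (n + 1 : ℝ)) (dualSize ζ)) (fun ζ => by positivity)
    (fun ζ => by
      rw [zero_mul]
      exact (dualGen_dualSize (fun n : ℕ => (n + 1 : ℝ)) ζ).le)
    (fun K => ?_) t ξ
  refine (finite_dualSize_le ⌊K⌋₊).subset fun ζ hζ => Nat.le_floor ?_
  have hζ : (dualSize ζ + 1 : ℝ) ≤ K := hζ
  linarith

/-! ### The annihilation operator -/

lemma annihilation_congr {f g : DualConfig p → ℝ} {ξ : DualConfig p}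
    (h : ∀ ζ : DualConfig p, dualSize ζ + 1 = dualSize ξ → f ζ = g ζ) :
    annihilation p f ξ = annihilation p g ξ := by
  unfold annihilation
  congr 1
  · refine Finset.sum_congr rfl fun x _ => ?_
    by_cases hx : ξ.1.1 x = 0
    · simp [hx]
    · rw [h]
      have := ξ.1.size_remove hx
      simp only [dualSize]
      omega
  · congr 1
    · by_cases hx : ξ.2.1 = 0
      · simp [hx]
      · rw [h]
        simp only [dualSize]
        omega
    · by_cases hx : ξ.2.2 = 0
      · simp [hx]
      · rw [h]
        simp only [dualSize]
        omega

lemma annihilation_sum {κ : Type*} (s : Finset κ) (c : κ → ℝ) (f : κ → DualConfig p → ℝ)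
    (ξ : DualConfig p) :
    annihilation p (fun ζ => ∑ j ∈ s, c j * f j ζ) ξ = ∑ j ∈ s, c j * annihilation p (f j) ξ := by
  simp only [annihilation, mul_add, Finset.sum_add_distrib, Finset.mul_sum]
  rw [Finset.sum_comm]
  congr 1
  · exact Finset.sum_congr rfl fun j _ => Finset.sum_congr rfl fun x _ => by ring
  · congr 1 <;> exact Finset.sum_congr rfl fun j _ => by ring

lemma annihilation_iterate_eq_zero (f : DualConfig p → ℝ) {j : ℕ} {ξ : DualConfig p}
    (h : dualSize ξ < j) : (annihilation p)^[j] f ξ = 0 := by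
  induction j generalizing ξ with
  | zero => omega
  | succ j ih =>
    rw [Function.iterate_succ_apply', annihilation_congr (g := fun _ => 0) fun ζ hζ =>
      ih (by omega)]
    simp [annihilation]

/-- Each factor, reservoir powers included, differentiates in `θ` to minus its own annihilation; the
product rule sums over sites. -/
lemma hasDerivAt_orthogonalDuality (θ : ℝ) (ξ : DualConfig p) (η : Config p) :
    HasDerivAt (fun ϑ => orthogonalDuality p ϑ ξ η)
      (-annihilation p (fun ζ => orthogonalDuality p θ ζ η) ξ) θ := by
  have hL : ∀ (a : ℝ) (n : ℕ), HasDerivAt (fun ϑ : ℝ => (a - ϑ) ^ n)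
      (n * (a - θ) ^ (n - 1) * -1) θ := fun a n =>
    ((hasDerivAt_id θ).const_sub a).fun_pow n
  have hP : HasDerivAt (fun ϑ => siteProd p ϑ ξ.1.1 η.1)
      (-∑ x, ξ.1.1 x * siteProd p θ (ξ.1.remove x).1 η.1) θ := by
    unfold siteProd
    refine (HasDerivAt.fun_finsetProd fun x _ => hasDerivAt_binomialTransform θ
      (fun l => classicalSite σ (p.α x) l (η.1 x)) (ξ.1.1 x)).congr_deriv ?_
    rw [← Finset.sum_neg_distrib]
    refine Finset.sum_congr rfl fun x _ => ?_
    rw [← Finset.mul_prod_erase _ _ (Finset.mem_univ x), Config.remove_val, smul_eq_mul]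
    have h : ∏ z ∈ Finset.univ.erase x, transformedSite σ θ (p.α z)
          ((ξ.1.1 - Pi.single x 1 : Fin (N + 1) → ℕ) z) (η.1 z) =
        ∏ z ∈ Finset.univ.erase x, binomialTransform θ
          (fun l => classicalSite σ (p.α z) l (η.1 z)) (ξ.1.1 z) := by
      refine Finset.prod_congr rfl fun z hz => ?_
      rw [Pi.sub_apply, Pi.single_eq_of_ne (Finset.ne_of_mem_erase hz), Nat.sub_zero]
      rfl
    rw [h, Pi.sub_apply, Pi.single_eq_same]
    unfold transformedSite
    ring
  simp only [annihilation, orthogonalDuality_eq]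
  refine (((hL p.θL ξ.2.1).fun_mul hP).fun_mul (hL p.θR ξ.2.2)).congr_deriv ?_
  have h : ∑ x, (ξ.1.1 x : ℝ) * ((p.θL - θ) ^ ξ.2.1 * siteProd p θ (ξ.1.remove x).1 η.1 *
      (p.θR - θ) ^ ξ.2.2) = (p.θL - θ) ^ ξ.2.1 * (p.θR - θ) ^ ξ.2.2 *
        ∑ x, ξ.1.1 x * siteProd p θ (ξ.1.remove x).1 η.1 := by
    rw [Finset.mul_sum]
    exact Finset.sum_congr rfl fun x _ => by ring
  linear_combination h

lemma orthogonalDuality_zero (ξ : DualConfig p) (η : Config p) :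
    orthogonalDuality p 0 ξ η = classicalDuality p ξ η := by
  simp [orthogonalDuality, classicalDuality, orthogonalSite]

/-- Both sides agree at `θ = 0`. Their `θ`-derivatives at `ξ` involve only configurations with one
particle fewer, where the identity holds by induction for every `θ`, so their difference is
constant. -/
lemma sum_annihilation_iterate (η : Config p) {M : ℕ} {ξ : DualConfig p} (h : dualSize ξ < M)
    (θ : ℝ) :
    ∑ j ∈ Finset.range M, (-θ) ^ j / (j.factorial : ℝ) *
      (annihilation p)^[j] (fun ζ => classicalDuality p ζ η) ξ = orthogonalDuality p θ ξ η := by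
  induction M generalizing ξ θ with
  | zero => omega
  | succ M ih =>
    set a : ℕ → DualConfig p → ℝ :=
      fun j => (annihilation p)^[j] fun ζ => classicalDuality p ζ η with ha
    have hterm : ∀ j : ℕ, ∀ ϑ : ℝ, HasDerivAt
        (fun ϑ : ℝ => (-ϑ) ^ (j + 1) / ((j + 1).factorial : ℝ) * a (j + 1) ξ)
        (-((-ϑ) ^ j / (j.factorial : ℝ) * annihilation p (a j) ξ)) ϑ := by
      intro j ϑ
      have h1 : HasDerivAt (fun ϑ : ℝ => (-ϑ) ^ (j + 1)) ((j + 1 : ℕ) * (-ϑ) ^ j * -1) ϑ :=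
        (hasDerivAt_id ϑ).fun_neg.fun_pow (j + 1)
      refine ((h1.div_const _).mul_const _).congr_deriv ?_
      have h2 : a (j + 1) ξ = annihilation p (a j) ξ := by
        rw [ha]
        simp only [Function.iterate_succ_apply']
      rw [h2, Nat.factorial_succ]
      have h3 : (j.factorial : ℝ) ≠ 0 := by exact_mod_cast j.factorial_ne_zero
      have h4 : (j + 1 : ℝ) ≠ 0 := by positivity
      push_cast
      field_simp
    have hder : ∀ ϑ : ℝ, HasDerivAt (fun ϑ => ∑ j ∈ Finset.range (M + 1),
        (-ϑ) ^ j / (j.factorial : ℝ) * a j ξ - orthogonalDuality p ϑ ξ η) 0 ϑ := by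
      intro ϑ
      simp only [Finset.sum_range_succ', pow_zero]
      refine (((HasDerivAt.fun_sum fun j _ => hterm j ϑ).add_const _).fun_sub
        (hasDerivAt_orthogonalDuality ϑ ξ η)).congr_deriv ?_
      rw [annihilation_congr (f := fun ζ => orthogonalDuality p ϑ ζ η)
        (g := fun ζ => ∑ j ∈ Finset.range M, (-ϑ) ^ j / (j.factorial : ℝ) * a j ζ)
        fun ζ hζ => (ih (by omega) ϑ).symm, annihilation_sum, Finset.sum_neg_distrib]
      ring
    have hconst := is_const_of_deriv_eq_zero (fun ϑ => (hder ϑ).differentiableAt)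
      (fun ϑ => (hder ϑ).deriv) θ 0
    simp only [Finset.sum_range_succ', neg_zero, orthogonalDuality_zero] at hconst
    rw [← sub_eq_zero, Finset.sum_range_succ', hconst]
    simp [ha]

lemma hasSum_annihilation_iterate (θ : ℝ) (ξ : DualConfig p) (η : Config p) :
    HasSum (fun j : ℕ => (-θ) ^ j / (j.factorial : ℝ) *
      (annihilation p)^[j] (fun ζ => classicalDuality p ζ η) ξ) (orthogonalDuality p θ ξ η) := by
  rw [← sum_annihilation_iterate η (Nat.lt_succ_self (dualSize ξ)) θ]
  refine hasSum_sum_of_ne_finset_zero fun j hj => ?_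
  rw [annihilation_iterate_eq_zero _ (by simpa using hj), mul_zero]

end Duality

end ParticleDuality

theorem mainTheorem3 (σ : SignType) (N : ℕ) (p : ParticleDuality.Params σ N) (θ : ℝ)
    (hθ : θ ∈ ParticleDuality.scaleSet σ) :
    -- duality at the level of generators
    (∀ (ξ : ParticleDuality.DualConfig p) (η : ParticleDuality.Config p),
      ParticleDuality.dualGen p (fun ζ => ParticleDuality.orthogonalDuality p θ ζ η) ξ =
        ParticleDuality.gen p (fun ζ => ParticleDuality.orthogonalDuality p θ ξ ζ) η) ∧
    -- duality at the level of the laws at time t (which are probability measures: no explosion)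
    (∀ (ξ : ParticleDuality.DualConfig p) (η : ParticleDuality.Config p) (t : ℝ≥0),
      IsProbabilityMeasure (ParticleDuality.lawAt (ParticleDuality.dualGen p) ξ t) ∧
      IsProbabilityMeasure (ParticleDuality.lawAt (ParticleDuality.gen p) η t) ∧
      Integrable (fun ζ => ParticleDuality.orthogonalDuality p θ ζ η)
        (ParticleDuality.lawAt (ParticleDuality.dualGen p) ξ t) ∧
      Integrable (fun ζ => ParticleDuality.orthogonalDuality p θ ξ ζ)
        (ParticleDuality.lawAt (ParticleDuality.gen p) η t) ∧
      ∫ ζ, ParticleDuality.orthogonalDuality p θ ζ η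
          ∂(ParticleDuality.lawAt (ParticleDuality.dualGen p) ξ t) =
        ∫ ζ, ParticleDuality.orthogonalDuality p θ ξ ζ
          ∂(ParticleDuality.lawAt (ParticleDuality.gen p) η t)) ∧
    -- the same for any realisation of the two Markov processes
    (∀ (Ω Ω' : Type) (_ : MeasurableSpace Ω) (_ : MeasurableSpace Ω')
      (P : Measure Ω) (P' : Measure Ω')
      (X : ℝ≥0 → Ω → ParticleDuality.Config p) (Y : ℝ≥0 → Ω' → ParticleDuality.DualConfig p)
      (η : ParticleDuality.Config p) (ξ : ParticleDuality.DualConfig p),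
      ParticleDuality.IsMarkovChain (ParticleDuality.gen p) P X η →
      ParticleDuality.IsMarkovChain (ParticleDuality.dualGen p) P' Y ξ →
      ∀ t : ℝ≥0,
        Integrable (fun ω => ParticleDuality.orthogonalDuality p θ (Y t ω) η) P' ∧
        Integrable (fun ω => ParticleDuality.orthogonalDuality p θ ξ (X t ω)) P ∧
        ∫ ω, ParticleDuality.orthogonalDuality p θ (Y t ω) η ∂P' =
          ∫ ω, ParticleDuality.orthogonalDuality p θ ξ (X t ω) ∂P) ∧
    -- the duality function is `exp (-θ K)` applied to the classical one in the dual variable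
    (∀ (ξ : ParticleDuality.DualConfig p) (η : ParticleDuality.Config p),
      HasSum (fun j : ℕ => (-θ) ^ j / (j.factorial : ℝ) *
          ((ParticleDuality.annihilation p)^[j]
            (fun ζ => ParticleDuality.classicalDuality p ζ η)) ξ)
        (ParticleDuality.orthogonalDuality p θ ξ η)) := by
  refine ⟨ParticleDuality.dualGen_orthogonalDuality θ, fun ξ η t => ?_,
    fun Ω Ω' _ _ P P' X Y η ξ hX hY t => ?_, ParticleDuality.hasSum_annihilation_iterate θ⟩
  · obtain ⟨i₁, e₁⟩ := ParticleDuality.integral_lawAt_dualGen θ ξ η t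
    obtain ⟨i₂, e₂⟩ := ParticleDuality.integral_lawAt_gen θ ξ η t
    exact ⟨ParticleDuality.isProbabilityMeasure_lawAt_dualGen ξ t,
      ParticleDuality.isProbabilityMeasure_lawAt_gen η t, i₁, i₂, e₁.trans e₂.symm⟩
  · obtain ⟨i₁, e₁⟩ := ParticleDuality.integral_lawAt_dualGen θ ξ η t
    obtain ⟨i₂, e₂⟩ := ParticleDuality.integral_lawAt_gen θ ξ η t
    have hXm := (hX.measurable t).aemeasurable (μ := P)
    have hYm := (hY.measurable t).aemeasurable (μ := P')
    have sm₁ : AEStronglyMeasurable (fun ζ => ParticleDuality.orthogonalDuality p θ ζ η)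
        (P'.map (Y t)) := Measurable.of_discrete.aestronglyMeasurable
    have sm₂ : AEStronglyMeasurable (fun ζ => ParticleDuality.orthogonalDuality p θ ξ ζ)
        (P.map (X t)) := Measurable.of_discrete.aestronglyMeasurable
    rw [← hY.map_eq t] at i₁ e₁
    rw [← hX.map_eq t] at i₂ e₂
    refine ⟨i₁.comp_aemeasurable hYm, i₂.comp_aemeasurable hXm, ?_⟩
    rw [← integral_map hYm sm₁, ← integral_map hXm sm₂, e₁, e₂]
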